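/- Let $\ell\ge 1$ and let $\beta(x,y)=\sum_{i=1}^{2\ell}x_iy_{2\ell+1-i}$ on $\mathbb{C}^{2\ell}$, with standard basis $e_1,\dots,e_{2\ell}$; write $e_{-j}:=e_{2\ell+1-j}$ for $1\le j\le \ell$. Let $SO(2\ell)$ be the group of $g\in SL(2\ell,\mathbb{C})$ preserving $\beta$, let $B_{2\ell}$ be its subgroup of upper triangular matrices, let $K=SO(2\ell-1)$ be the subgroup of $SO(2\ell)$ fixing the vector $e_\ell-e_{-\ell}$, and let $B_{2\ell-1}:=K\cap B_{2\ell}$. The flag variety $\mathcal{B}_{2\ell}$ of $SO(2\ell)$ is the set of isotropic flags $V_1\subset\dots\subset V_{\ell-1}$ in $\mathbb{C}^{2\ell}$ with $\dim V_i=i$. We write such a flag as $(v_1\subset\dots\subset v_{\ell-1})$ if $V_i=\operatorname{span}\{v_1,\dots,v_i\}$ for all $i$. For $1\le i\le \ell-1$ define the hat vector $\hat e_i:=e_{-i}+e_{-\ell}$ and the tilde vector $\tilde e_i:=e_{-i}+e_{\ell}$. An isotropic flag $\mathcal{F}=(v_1\subset\dots\subset v_{\ell-1})$ is in standard form if each $v_i$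 is a standard basis vector $e_j$ ($j\in\{\pm1,\dots,\pm\ell\}$), a hat vector or a tilde vector, and (a) if $v_i=e_{\pm\ell}$, then $v_k$ is a standard basis vector for all $k>i$; (b) if a tilde vector occurs among the $v_i$, then $e_\ell$ also occurs; (c) if $v_i=\hat e_a$ and $v_k=\hat e_b$ with $i<k$, then $a<b$; likewise for tilde vectors; (d) $\hat e_i$ and $e_{-i}$ do not both occur, and $\tilde e_i$ and $e_{-i}$ do not both occur. A signed list of $\{1,\dots,\ell\}$ is a tuple of elements of $\{\pm1,\dots,\pm\ell\}$ whose entries have distinct absolute values. Let $SPIL(\ell)$ be the set of all finite sets $\Sigma$ of non-empty signed lists of $\{1,\dots,\ell\}$ such that the last entry of each list is positive and each $a\in\{1,\dots,\ell\}$ is the absolute value of an entry of exactly one list in $\Sigma$. For $\Sigma\in SPIL(\ell)$, order its lists $\sigma_j=(i_{j,1},\dots,i_{j,k_j})$, $1\le j\le t$, so that $\ell$ or $-\ell$ is an entry of $\sigma_t$ and $i_{1,k_1}<\dots<i_{t-1,k_{t-1}}$. Let $$\Gamma(\Sigma):=(e_{i_{1,1}}\subset\dots\subset e_{i_{1,k_1-1}}\subset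 h_{i_{1,k_1}}\subset\dots\subset e_{i_{t-1,1}}\subset\dots\subset h_{i_{t-1,k_{t-1}}}\subset e_{i_{t,1}}\subset\dots\subset e_{i_{t,k_t-1}}),$$ where $h_i=\hat e_i$ if $\sigma_t$ ends in $\ell$ or contains $-\ell$, and $h_i=\tilde e_i$ otherwise. Theorem. The map $\Psi:\mathcal{F}\mapsto B_{2\ell-1}\cdot\mathcal{F}$ is a bijection from the set of $SO(2\ell)$-flags in standard form onto the set of $B_{2\ell-1}$-orbits on $\mathcal{B}_{2\ell}$; that is, every orbit contains exactly one flag in standard form. Moreover $\Gamma$ is a well-defined bijection from $SPIL(\ell)$ onto the set of $SO(2\ell)$-flags in standard form, so that $\Psi\circ\Gamma$ is a bijection from $SPIL(\ell)$ onto the set of $B_{2\ell-1}$-orbits on $\mathcal{B}_{2\ell}$. -/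

import Mathlib

namespace OrthFlags

/-- The symmetric bilinear form `β(x, y) = xᵀ S y` on `ℂⁿ`, where `S` is the permutation matrix
sending `e_i` to `e_{n+1-i}`. -/
def beta {n : ℕ} (x y : Fin n → ℂ) : ℂ := ∑ i, x i * y i.rev

/-- `SO(n)`, the group of all `g ∈ SL(n)` with `β(gx, gy) = β(x, y)` for all `x, y ∈ ℂⁿ`. -/
def SO (n : ℕ) : Subgroup (Matrix.SpecialLinearGroup (Fin n) ℂ) where
  carrier := {g | ∀ x y : Fin n → ℂ, beta (g.1.mulVec x) (g.1.mulVec y) = beta x y}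
  one_mem' := by intro x y; simp
  mul_mem' := by
    intro a b ha hb x y
    have := ha (b.1.mulVec x) (b.1.mulVec y)
    simp only [Matrix.mulVec_mulVec] at this
    exact this.trans (hb x y)
  inv_mem' := by
    intro a ha x y
    have h1 : a.1 * (a⁻¹).1 = 1 := by
      have := congrArg Subtype.val (mul_inv_cancel a)
      simpa only [Matrix.SpecialLinearGroup.coe_mul, Matrix.SpecialLinearGroup.coe_one] using this
    have := ha ((a⁻¹).1.mulVec x) ((a⁻¹).1.mulVec y)
    simp only [Matrix.mulVec_mulVec, h1, Matrix.one_mulVec] at this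
    exact this.symm

/-- The underlying matrix of an element of `SO(n)`. -/
def SO.mat {n : ℕ} (g : SO n) : Matrix (Fin n) (Fin n) ℂ := g.1.1

theorem SO.mat_one {n : ℕ} : SO.mat (1 : SO n) = 1 := rfl

theorem SO.mat_mul {n : ℕ} (g h : SO n) : SO.mat (g * h) = SO.mat g * SO.mat h := rfl

theorem SO.mat_mul_inv {n : ℕ} (g : SO n) : SO.mat g * SO.mat g⁻¹ = 1 := by
  rw [← SO.mat_mul, mul_inv_cancel, SO.mat_one]

theorem SO.mat_inv_mul {n : ℕ} (g : SO n) : SO.mat g⁻¹ * SO.mat g = 1 := by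
  rw [← SO.mat_mul, inv_mul_cancel, SO.mat_one]

/-- The standard Borel subgroup `B_n` of `SO(n)`: the upper triangular matrices in `SO(n)`. -/
def borel (n : ℕ) : Subgroup (SO n) where
  carrier := {g | ∀ i j : Fin n, j < i → SO.mat g i j = 0}
  one_mem' := by
    intro i j hij
    rw [SO.mat_one, Matrix.one_apply_ne hij.ne']
  mul_mem' := by
    intro a b ha hb
    have h : (SO.mat a * SO.mat b).BlockTriangular id :=
      Matrix.BlockTriangular.mul (fun i j hij => ha i j hij) (fun i j hij => hb i j hij)
    intro i j hij
    rw [SO.mat_mul]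
    exact h hij
  inv_mem' := by
    intro a ha
    have h : (SO.mat a).BlockTriangular id := fun i j hij => ha i j hij
    let _ : Invertible (SO.mat a) := ⟨SO.mat a⁻¹, SO.mat_inv_mul a, SO.mat_mul_inv a⟩
    have h' : (SO.mat a)⁻¹ = SO.mat a⁻¹ := Matrix.inv_eq_right_inv (SO.mat_mul_inv a)
    have h2 := Matrix.blockTriangular_inv_of_blockTriangular h
    rw [h'] at h2
    exact fun i j hij => h2 hij

/-- The standard basis of `ℂ^{2ℓ}` labelled by `±1, …, ±ℓ`: for `1 ≤ j ≤ ℓ`, `e_j` is the `j`-th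
standard basis vector and `e_{-j}` is the `(2ℓ+1-j)`-th one. (Coordinates are numbered from `0` in
`Fin (2 * ℓ)`, so coordinate `k` is the `(k+1)`-st; other labels are never used.) -/
def e (ℓ : ℕ) (j : ℤ) : Fin (2 * ℓ) → ℂ := fun k =>
  if (k : ℤ) + 1 = (if 0 < j then j else 2 * ℓ + 1 + j) then 1 else 0

/-- The hat vector `ê_j = e_{-j} + e_{-ℓ}` (for `1 ≤ j ≤ ℓ - 1`). -/
def hat (ℓ : ℕ) (j : ℤ) : Fin (2 * ℓ) → ℂ := e ℓ (-j) + e ℓ (-ℓ)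

/-- The tilde vector `ẽ_j = e_{-j} + e_ℓ` (for `1 ≤ j ≤ ℓ - 1`). -/
def tilde (ℓ : ℕ) (j : ℤ) : Fin (2 * ℓ) → ℂ := e ℓ (-j) + e ℓ ℓ

/-- The subgroup `K = SO(2ℓ-1)` of `SO(2ℓ)`: the elements of `SO(2ℓ)` that fix the anisotropic
vector `e_ℓ - e_{-ℓ}`. By restriction these are exactly the isometries of determinant one of the
orthogonal complement `U₁ = span {e_{±1}, …, e_{±(ℓ-1)}, e_ℓ + e_{-ℓ}}` of that vector. -/
def K (ℓ : ℕ) : Subgroup (SO (2 * ℓ)) where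
  carrier := {g | (SO.mat g).mulVec (e ℓ ℓ - e ℓ (-ℓ)) = e ℓ ℓ - e ℓ (-ℓ)}
  one_mem' := by
    show (SO.mat 1).mulVec _ = _
    rw [SO.mat_one, Matrix.one_mulVec]
  mul_mem' := by
    intro a b ha hb
    show (SO.mat (a * b)).mulVec _ = _
    rw [SO.mat_mul, ← Matrix.mulVec_mulVec]
    exact (congrArg _ hb).trans ha
  inv_mem' := by
    intro a ha
    show (SO.mat a⁻¹).mulVec _ = _
    have h := congrArg (SO.mat a⁻¹).mulVec ha
    rw [Matrix.mulVec_mulVec, SO.mat_inv_mul, Matrix.one_mulVec] at h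
    exact h.symm

/-- `B_{2ℓ-1} = K ∩ B_{2ℓ}`. -/
def B (ℓ : ℕ) : Subgroup (SO (2 * ℓ)) := K ℓ ⊓ borel (2 * ℓ)

/-- The flag variety of `SO(2ℓ)`: isotropic flags `V_1 ⊂ ⋯ ⊂ V_{ℓ-1}` in `ℂ^{2ℓ}` with
`dim V_m = m`. The subspace `V_m` is `V ⟨m - 1, _⟩`. -/
@[ext]
structure IsoFlag (ℓ : ℕ) where
  V : Fin (ℓ - 1) → Submodule ℂ (Fin (2 * ℓ) → ℂ)
  mono : Monotone V
  finrank_eq : ∀ m, Module.finrank ℂ (V m) = (m : ℕ) + 1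
  isotropic : ∀ m, ∀ x ∈ V m, ∀ y ∈ V m, beta x y = 0

/-- The image of an isotropic flag under an element of `SO(2ℓ)`. -/
def IsoFlag.act {ℓ : ℕ} (g : SO (2 * ℓ)) (F : IsoFlag ℓ) : IsoFlag ℓ where
  V m := (F.V m).map (SO.mat g).mulVecLin
  mono := fun _ _ h => Submodule.map_mono (F.mono h)
  finrank_eq := by
    intro m
    rw [← F.finrank_eq m]
    have hinj : Function.Injective (SO.mat g).mulVecLin := by
      intro x y hxy
      have h := congrArg (SO.mat g⁻¹).mulVec hxy
      simpa [Matrix.mulVec_mulVec, SO.mat_inv_mul] using h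
    exact (Submodule.equivMapOfInjective _ hinj (F.V m)).finrank_eq.symm
  isotropic := by
    rintro m _ ⟨x, hx, rfl⟩ _ ⟨y, hy, rfl⟩
    exact (g.2 x y).trans (F.isotropic m x hx y hy)

instance (ℓ : ℕ) : MulAction (SO (2 * ℓ)) (IsoFlag ℓ) where
  smul := IsoFlag.act
  one_smul := by
    intro F
    refine IsoFlag.ext (funext fun m => ?_)
    show (F.V m).map (SO.mat 1).mulVecLin = F.V m
    rw [SO.mat_one, Matrix.mulVecLin_one, Submodule.map_id]
  mul_smul := by
    intro g h F
    refine IsoFlag.ext (funext fun m => ?_)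
    show (F.V m).map (SO.mat (g * h)).mulVecLin
      = ((F.V m).map (SO.mat h).mulVecLin).map (SO.mat g).mulVecLin
    rw [SO.mat_mul, Matrix.mulVecLin_mul, Submodule.map_comp]

/-- The set of `B_{2ℓ-1}`-orbits on the flag variety of `SO(2ℓ)`. -/
abbrev Orbits (ℓ : ℕ) : Type := MulAction.orbitRel.Quotient (B ℓ) (IsoFlag ℓ)

/-- `F = (v_1 ⊂ ⋯ ⊂ v_{ℓ-1})`, that is, `V_m = span {v_1, …, v_m}` for all `m`. -/
def IsoFlag.SpannedBy {ℓ : ℕ} (F : IsoFlag ℓ) (v : Fin (ℓ - 1) → Fin (2 * ℓ) → ℂ) : Prop :=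
  ∀ m, F.V m = Submodule.span ℂ (v '' {i | i ≤ m})

/-- `w` is one of the standard basis vectors `e_{±1}, …, e_{±ℓ}`. -/
def IsStd (ℓ : ℕ) (w : Fin (2 * ℓ) → ℂ) : Prop :=
  ∃ j : ℤ, 1 ≤ |j| ∧ |j| ≤ ℓ ∧ w = e ℓ j

/-- `w` is the hat vector `ê_j`, `1 ≤ j ≤ ℓ - 1`. -/
def IsHat (ℓ : ℕ) (j : ℤ) (w : Fin (2 * ℓ) → ℂ) : Prop := 1 ≤ j ∧ j < ℓ ∧ w = hat ℓ j

/-- `w` is the tilde vector `ẽ_j`, `1 ≤ j ≤ ℓ - 1`. -/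
def IsTilde (ℓ : ℕ) (j : ℤ) (w : Fin (2 * ℓ) → ℂ) : Prop := 1 ≤ j ∧ j < ℓ ∧ w = tilde ℓ j

/-- The requirements on the vectors `v_1, …, v_{ℓ-1}` of a flag in standard form. -/
structure IsStandardTuple (ℓ : ℕ) (v : Fin (ℓ - 1) → Fin (2 * ℓ) → ℂ) : Prop where
  form : ∀ i, IsStd ℓ (v i) ∨ (∃ j, IsHat ℓ j (v i)) ∨ (∃ j, IsTilde ℓ j (v i))
  cond_a : ∀ i, (v i = e ℓ ℓ ∨ v i = e ℓ (-ℓ)) → ∀ k, i < k → IsStd ℓ (v k)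
  cond_b : (∃ i j, IsTilde ℓ j (v i)) → ∃ i, v i = e ℓ ℓ
  cond_c_hat : ∀ i k, i < k → ∀ a b, IsHat ℓ a (v i) → IsHat ℓ b (v k) → a < b
  cond_c_tilde : ∀ i k, i < k → ∀ a b, IsTilde ℓ a (v i) → IsTilde ℓ b (v k) → a < b
  cond_d_hat : ∀ i k j, IsHat ℓ j (v i) → v k ≠ e ℓ (-j)
  cond_d_tilde : ∀ i k j, IsTilde ℓ j (v i) → v k ≠ e ℓ (-j)

/-- The isotropic flag `F` is in standard form. -/
def IsoFlag.IsStandard {ℓ : ℕ} (F : IsoFlag ℓ) : Prop :=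
  ∃ v, F.SpannedBy v ∧ IsStandardTuple ℓ v

/-- The set of `SO(2ℓ)`-flags in standard form. -/
abbrev StandardFlag (ℓ : ℕ) : Type := {F : IsoFlag ℓ // F.IsStandard}

/-- The map `Ψ` sending a flag `F` in standard form to its orbit `B_{2ℓ-1} · F`. -/
def Psi (ℓ : ℕ) (F : StandardFlag ℓ) : Orbits ℓ := Quotient.mk _ F.1

/-- `S` is a signed partition into lists of the set `A` of non-negative integers: a finite set of
non-empty signed lists of `A` (no two entries of a list agree up to sign) such that the lists of
absolute values partition `A`, the last entry of each list is non-negative, and `0` can only occur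
as a last entry. -/
structure IsSPIL (A : Finset ℕ) (S : Finset (List ℤ)) : Prop where
  nonempty : ∀ σ ∈ S, σ ≠ []
  mem : ∀ σ ∈ S, ∀ x ∈ σ, x.natAbs ∈ A
  nodup : ∀ σ ∈ S, (σ.map Int.natAbs).Nodup
  partition : ∀ a ∈ A, ∃! σ, σ ∈ S ∧ a ∈ σ.map Int.natAbs
  last_nonneg : ∀ σ ∈ S, ∀ x, σ.getLast? = some x → 0 ≤ x
  zero_last : ∀ σ ∈ S, (0 : ℤ) ∈ σ → σ.getLast? = some 0

/-- `SPIL(ℓ)`, the set of signed partitions into lists of `{1, …, ℓ}`. -/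
abbrev SPIL (ℓ : ℕ) : Type := {S : Finset (List ℤ) // IsSPIL (Finset.Icc 1 ℓ) S}

/-- The vectors `e_{i_1}, …, e_{i_{k-1}}, h_{i_k}` attached to a list `(i_1, …, i_k)`. -/
def blockVectors (ℓ : ℕ) (h : ℤ → Fin (2 * ℓ) → ℂ) (σ : List ℤ) : List (Fin (2 * ℓ) → ℂ) :=
  σ.dropLast.map (e ℓ) ++ σ.getLast?.toList.map h

open Classical in
/-- The vectors of the flag attached to the lists `σ_1, …, σ_{t-1}` (in this order) and `σ_t = τ`.
If `τ` ends in `ℓ` or contains `-ℓ`, the last entries of `σ_1, …, σ_{t-1}` give hat vectors;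
otherwise they give tilde vectors. The last entry of `τ` is omitted. -/
noncomputable def gammaVectors (ℓ : ℕ) (L : List (List ℤ)) (τ : List ℤ) :
    List (Fin (2 * ℓ) → ℂ) :=
  L.flatMap (blockVectors ℓ
    (if τ.getLast? = some (ℓ : ℤ) ∨ (-ℓ : ℤ) ∈ τ then hat ℓ else tilde ℓ))
    ++ τ.dropLast.map (e ℓ)

/-- `F` is the flag `Γ(S)`: the lists of `S` are `σ_1, …, σ_t`, ordered so that `σ_t` contains
`ℓ` or `-ℓ` and the last entries of `σ_1, …, σ_{t-1}` increase, and `F = (v_1 ⊂ ⋯ ⊂ v_{ℓ-1})`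
for the vectors attached to this ordering. -/
def IsGamma {ℓ : ℕ} (S : SPIL ℓ) (F : IsoFlag ℓ) : Prop :=
  ∃ (L : List (List ℤ)) (τ : List ℤ) (v : Fin (ℓ - 1) → Fin (2 * ℓ) → ℂ),
    (L ++ [τ]).Nodup ∧ (∀ σ, σ ∈ L ++ [τ] ↔ σ ∈ S.1) ∧
    ((ℓ : ℤ) ∈ τ ∨ (-ℓ : ℤ) ∈ τ) ∧
    L.Pairwise (fun σ σ' => ∀ a b, σ.getLast? = some a → σ'.getLast? = some b → a < b) ∧
    List.ofFn v = gammaVectors ℓ L τ ∧ F.SpannedBy v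

end OrthFlags

/-! A flag in standard form is a word of `ℓ - 1` letters `(k, b)`: `k` is the lead, the last
position where the vector is non-zero, and `b` says whether a middle summand `e_{±ℓ}` is added. All
added summands are `e_ℓ` if `e_ℓ` itself is a letter, and `e_{-ℓ}` otherwise (`tl`). Isotropy leaves
no other choice, given condition (b). Conditions (a), (c), (d) and isotropy become the pairwise
relation `Ok`, so standard flags correspond to good words (`IsWord.isStandard`,
`exists_isWord_of_isStandard`, `exists_isWord`).

Every orbit meets a good word (`exists_smul_isWord`). Given a word for the smaller subspaces, take a
vector of the next subspace outside their span, clear the leads already used, and look at its own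
lead `k` and at its pairing with `u = e_ℓ - e_{-ℓ}`, which is invariant under `B ℓ`. Eichler
transformations and torus elements of `B ℓ` carry a standard basis or hat vector to a suitable
vector of the subspace and preserve the lines of the earlier vectors (`exists_extends`). The
delicate case is a vector with lead `e_ℓ`: there all earlier hat vectors have to turn into tilde
vectors (`extends_of_pl`).

The word is an orbit invariant (`IsWord.eq_of_smul_eq`). Upper triangular matrices preserve leads,
which determines every `k`. A letter with lead outside the middle is unmarked exactly when its
subspace contains a vector with that lead orthogonal to `u`, which determines every `b`.

Finally, words correspond to signed partitions. Mark the last entry of each of `σ_1, …, σ_{t-1}` and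
omit the last entry of `σ_t`; cutting a word after its marked letters recovers the lists (`decode`),
and the omitted entry is positive with the one absolute value that is missing (`eq_of_encode_eq`,
`ZGood.exists_isListing`). That `σ_t` contains `±ℓ` and that the last entries increase is exactly
what the order conditions on marked letters say. -/

namespace OrthFlags

/-! ### The form `β`, Eichler transformations, and elements of `B_{2ℓ-1}`. -/

section
variable {ℓ : ℕ}

theorem beta_add_left {n : ℕ} (x y z : Fin n → ℂ) : beta (x + y) z = beta x z + beta y z := by
  simp [beta, add_mul, Finset.sum_add_distrib]

theorem beta_smul_left {n : ℕ} (c : ℂ) (x z : Fin n → ℂ) : beta (c • x) z = c * beta x z := by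
  simp [beta, mul_assoc, Finset.mul_sum]

theorem beta_comm {n : ℕ} (x y : Fin n → ℂ) : beta x y = beta y x := by
  unfold beta
  rw [← Equiv.sum_comp Fin.revPerm]
  simp [mul_comm]

theorem beta_add_right {n : ℕ} (x y z : Fin n → ℂ) : beta x (y + z) = beta x y + beta x z := by
  rw [beta_comm, beta_add_left, beta_comm y, beta_comm z]

theorem beta_smul_right {n : ℕ} (c : ℂ) (x z : Fin n → ℂ) : beta x (c • z) = c * beta x z := by
  rw [beta_comm, beta_smul_left, beta_comm]

theorem beta_sub_left {n : ℕ} (x y z : Fin n → ℂ) : beta (x - y) z = beta x z - beta y z := by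
  simp [beta, sub_mul]

theorem beta_sub_right {n : ℕ} (x y z : Fin n → ℂ) : beta x (y - z) = beta x y - beta x z := by
  rw [beta_comm, beta_sub_left, beta_comm y, beta_comm z]

theorem beta_zero_left {n : ℕ} (x : Fin n → ℂ) : beta 0 x = 0 := by simp [beta]

theorem beta_zero_right {n : ℕ} (x : Fin n → ℂ) : beta x 0 = 0 := by simp [beta]

/-- The standard basis vectors of `ℂⁿ`, indexed by positions. -/
def sg {n : ℕ} (k : Fin n) : Fin n → ℂ := Pi.single k 1

theorem sg_apply {n : ℕ} (k i : Fin n) : sg k i = if i = k then 1 else 0 := by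
  simp [sg, Pi.single_apply]

theorem beta_sg_right {n : ℕ} (x : Fin n → ℂ) (k : Fin n) : beta x (sg k) = x k.rev := by
  unfold beta
  rw [Finset.sum_eq_single k.rev]
  · simp [sg_apply]
  · intro i _ hi
    have : i.rev ≠ k := fun h => hi (by rw [← h, Fin.rev_rev])
    simp [sg_apply, this]
  · simp

theorem beta_sg_left {n : ℕ} (x : Fin n → ℂ) (k : Fin n) : beta (sg k) x = x k.rev := by
  rw [beta_comm, beta_sg_right]

theorem rev_ne (k : Fin (2 * ℓ)) : k.rev ≠ k := by
  intro h
  have := congrArg Fin.val h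
  rw [Fin.val_rev] at this
  omega

theorem e_pos_eq {j : ℤ} {k : Fin (2 * ℓ)} (hj : 0 < j) (h : (k : ℤ) + 1 = j) : e ℓ j = sg k := by
  ext i
  simp only [e, sg_apply, if_pos hj, Fin.ext_iff]
  congr 1
  apply propext
  omega

theorem e_neg_eq {j : ℤ} {k : Fin (2 * ℓ)} (hj : j < 0) (h : (k : ℤ) = 2 * ℓ + j) :
    e ℓ j = sg k := by
  ext i
  simp only [e, sg_apply, if_neg hj.not_gt, Fin.ext_iff]
  congr 1
  apply propext
  omega

/-- The Eichler transformation attached to an isotropic vector `a` and a vector `b ⊥ a`. -/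
noncomputable def eichler (a b : Fin (2 * ℓ) → ℂ) :
    (Fin (2 * ℓ) → ℂ) →ₗ[ℂ] (Fin (2 * ℓ) → ℂ) where
  toFun x := x + beta x a • b - (beta x b + beta b b / 2 * beta x a) • a
  map_add' x y := by
    ext i
    simp only [beta_add_left, Pi.add_apply, Pi.sub_apply, Pi.smul_apply, smul_eq_mul]; ring
  map_smul' c x := by
    ext i
    simp only [beta_smul_left, Pi.add_apply, Pi.sub_apply, Pi.smul_apply, smul_eq_mul,
      RingHom.id_apply]; ring

theorem eichler_apply (a b x : Fin (2 * ℓ) → ℂ) :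
    eichler a b x = x + beta x a • b - (beta x b + beta b b / 2 * beta x a) • a := rfl

/-- The term `β(b, b) / 2` in the coefficient of `a` cancels the square of `b`. -/
theorem eichler_iso {a b : Fin (2 * ℓ) → ℂ} (ha : beta a a = 0) (hab : beta a b = 0)
    (x y : Fin (2 * ℓ) → ℂ) : beta (eichler a b x) (eichler a b y) = beta x y := by
  simp only [eichler_apply, beta_add_left, beta_add_right, beta_sub_left, beta_sub_right,
    beta_smul_left, beta_smul_right, ha, hab, beta_comm b a, beta_comm b y, beta_comm a y]
  ring

theorem eichler_fix {a b x : Fin (2 * ℓ) → ℂ} (ha : beta x a = 0) (hb : beta x b = 0) :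
    eichler a b x = x := by
  simp [eichler_apply, ha, hb]

section Middle
variable [NeZero ℓ]

/-- The position of `e_ℓ`. -/
def pl (ℓ : ℕ) [NeZero ℓ] : Fin (2 * ℓ) := ⟨ℓ - 1, by have := NeZero.pos ℓ; omega⟩

/-- The position of `e_{-ℓ}`. -/
def ml (ℓ : ℕ) [NeZero ℓ] : Fin (2 * ℓ) := ⟨ℓ, by have := NeZero.pos ℓ; omega⟩

theorem rev_pl : (pl ℓ).rev = ml ℓ := by
  have := NeZero.pos ℓ
  ext; simp only [pl, ml, Fin.val_rev]; omega

theorem rev_ml : (ml ℓ).rev = pl ℓ := by rw [← rev_pl, Fin.rev_rev]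

theorem pl_ne_ml : pl ℓ ≠ ml ℓ := by
  have := NeZero.pos ℓ
  intro h; have := congrArg Fin.val h; simp only [pl, ml] at this; omega

theorem pl_lt_ml : pl ℓ < ml ℓ := by
  have := NeZero.pos ℓ
  simp only [pl, ml, Fin.mk_lt_mk]; omega

theorem le_ml_iff {i : Fin (2 * ℓ)} : i ≤ ml ℓ ↔ i < pl ℓ ∨ i = pl ℓ ∨ i = ml ℓ := by
  have := NeZero.pos ℓ
  simp only [pl, ml, Fin.le_def, Fin.lt_def, Fin.ext_iff]; omega

theorem rev_lt_pl {i : Fin (2 * ℓ)} : i.rev < pl ℓ ↔ ml ℓ < i := by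
  have := NeZero.pos ℓ
  have := i.2
  simp only [pl, ml, Fin.lt_def, Fin.val_rev]; omega

theorem ml_lt_rev {i : Fin (2 * ℓ)} : ml ℓ < i.rev ↔ i < pl ℓ := by
  rw [← rev_lt_pl, Fin.rev_rev]

theorem rev_eq_pl {i : Fin (2 * ℓ)} : i.rev = pl ℓ ↔ i = ml ℓ := by
  rw [← rev_ml, Fin.rev_inj]

theorem rev_eq_ml {i : Fin (2 * ℓ)} : i.rev = ml ℓ ↔ i = pl ℓ := by
  rw [← rev_pl, Fin.rev_inj]

/-- The vector `e_ℓ - e_{-ℓ}` fixed by `K`. -/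
def uvec (ℓ : ℕ) [NeZero ℓ] : Fin (2 * ℓ) → ℂ := sg (pl ℓ) - sg (ml ℓ)

theorem beta_uvec (x : Fin (2 * ℓ) → ℂ) : beta (uvec ℓ) x = x (ml ℓ) - x (pl ℓ) := by
  rw [uvec, beta_sub_left, beta_sg_left, beta_sg_left, rev_pl, rev_ml]

theorem e_self : e ℓ ℓ = sg (pl ℓ) := by
  have := NeZero.pos ℓ
  exact e_pos_eq (by omega) (by simp only [pl]; omega)

theorem e_neg_self : e ℓ (-ℓ) = sg (ml ℓ) := by
  have := NeZero.pos ℓ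
  exact e_neg_eq (by omega) (by simp only [ml]; omega)

theorem uvec_eq : e ℓ ℓ - e ℓ (-ℓ) = uvec ℓ := by rw [e_self, e_neg_self, uvec]

/-- Upper triangular isometries fixing `e_ℓ - e_{-ℓ}` are elements of `B_{2ℓ-1}`. -/
theorem exists_mem_B (φ : (Fin (2 * ℓ) → ℂ) →ₗ[ℂ] (Fin (2 * ℓ) → ℂ))
    (iso : ∀ x y, beta (φ x) (φ y) = beta x y) (tri : ∀ k i, k < i → φ (sg k) i = 0)
    (fix : φ (uvec ℓ) = uvec ℓ) :
    ∃ g ∈ B ℓ, ∀ x, (SO.mat g).mulVec x = φ x := by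
  set M := LinearMap.toMatrix' φ with hM
  have hMv : ∀ x, M.mulVec x = φ x := fun x => LinearMap.toMatrix'_mulVec φ x
  have hMe : ∀ i k, M i k = φ (sg k) i := by
    intro i k
    rw [hM, LinearMap.toMatrix'_apply]; rfl
  have hdiag : ∀ k, M k k * M k.rev k.rev = 1 := by
    intro k
    have h := iso (sg k) (sg k.rev)
    rw [beta_sg_left, sg_apply, if_pos rfl] at h
    -- By triangularity the first factor vanishes at `i > k` and the second one at `i < k`.
    rw [← h, beta, Finset.sum_eq_single k]
    · rw [hMe, hMe]
    · intro i _ hik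
      rcases lt_or_gt_of_ne hik with h' | h'
      · rw [tri k.rev i.rev (Fin.rev_lt_rev.2 h'), mul_zero]
      · rw [tri k i h', zero_mul]
    · simp
  have htri : M.BlockTriangular id := fun i j hij => by rw [hMe]; exact tri j i hij
  have hdet : M.det = 1 := by
    rw [Matrix.det_of_isUpperTriangular htri]
    -- The diagonal entries at `k` and `k.rev` are inverse to each other, and no position equals its
    -- reverse.
    exact Finset.prod_involution (fun k _ => k.rev) (fun k _ => hdiag k)
      (fun k _ _ => rev_ne k) (fun _ _ => Finset.mem_univ _) (fun k _ => Fin.rev_rev k)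
  refine ⟨⟨⟨M, hdet⟩, fun x y => ?_⟩, ⟨?_, ?_⟩, hMv⟩
  · show beta (M.mulVec x) (M.mulVec y) = _
    rw [hMv, hMv, iso]
  · show M.mulVec _ = _
    rw [uvec_eq, hMv, fix]
  · exact fun i j hij => htri hij

theorem mem_B_uvec {g : SO (2 * ℓ)} (hg : g ∈ B ℓ) : (SO.mat g).mulVec (uvec ℓ) = uvec ℓ := by
  rw [← uvec_eq]; exact hg.1

/-- Moving an isotropic vector with leading position `k` to another one. -/
theorem exists_move_lead {k : Fin (2 * ℓ)} (hp : k ≠ pl ℓ) (hm : k ≠ ml ℓ)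
    {z x : Fin (2 * ℓ) → ℂ} (hz : beta z z = 0) (hx : beta x x = 0) (hzk : z k = 1) (hxk : x k = 1)
    (hz0 : ∀ j, k < j → z j = 0) (hx0 : ∀ j, k < j → x j = 0)
    (hu : beta (uvec ℓ) z = beta (uvec ℓ) x) :
    ∃ g ∈ B ℓ, (SO.mat g).mulVec z = x ∧
      ∀ v : Fin (2 * ℓ) → ℂ, v k = 0 → beta v z = beta v x → (SO.mat g).mulVec v = v := by
  set a : Fin (2 * ℓ) → ℂ := sg k.rev with ha
  -- The multiple of `a` also removes the coordinate at `k.rev`, so `b` vanishes at all positions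
  -- from `k` on. This makes the Eichler transformation upper triangular.
  set b := x - z - (x k.rev - z k.rev) • a with hb
  have hkr := rev_ne k
  have hβa : ∀ v, beta v a = v k := fun v => by rw [ha, beta_sg_right, Fin.rev_rev]
  have haa : beta a a = 0 := by rw [hβa, ha, sg_apply, if_neg hkr.symm]
  have hb0 : ∀ j, k ≤ j → b j = 0 := by
    intro j hj
    rcases hj.eq_or_lt with rfl | hj
    · simp [hb, ha, sg_apply, hkr.symm, hzk, hxk]
    · by_cases hjr : j = k.rev
      · subst hjr; simp [hb, ha, sg_apply]
      · simp [hb, ha, sg_apply, hjr, hz0 j hj, hx0 j hj]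
  have hab : beta a b = 0 := by rw [beta_comm, hβa]; exact hb0 k le_rfl
  have hfix : ∀ v : Fin (2 * ℓ) → ℂ, v k = 0 → beta v z = beta v x → eichler a b v = v := by
    intro v hv hvz
    refine eichler_fix (by rw [hβa, hv]) ?_
    rw [hb, beta_sub_right, beta_sub_right, beta_smul_right, hβa, hv, hvz]; ring
  have huk : uvec ℓ k = 0 := by simp [uvec, sg_apply, hp, hm]
  obtain ⟨g, hg, hgφ⟩ := exists_mem_B (eichler a b) (eichler_iso haa hab) (by
    intro m i hmi
    have h1 : sg m i = 0 := by rw [sg_apply, if_neg hmi.ne']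
    have h2 : beta (sg m) a * b i = 0 := by
      rw [hβa, sg_apply]
      split_ifs with h
      · rw [hb0 i (h ▸ hmi.le), mul_zero]
      · rw [zero_mul]
    have h3 : (beta (sg m) b + beta b b / 2 * beta (sg m) a) * a i = 0 := by
      by_cases hi : i = k.rev
      · have hmk : k < m.rev := by rw [← Fin.rev_lt_rev, Fin.rev_rev, ← hi]; exact hmi
        rw [beta_sg_left, hb0 _ hmk.le, hβa, sg_apply]
        split_ifs with h
        · subst h
          have : beta b b = 0 := by
            refine Finset.sum_eq_zero fun j _ => ?_
            rcases le_or_gt k j with h | h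
            · rw [hb0 j h, zero_mul]
            · rw [hb0 j.rev (hmk.le.trans (Fin.rev_le_rev.2 h.le)), mul_zero]
          simp [this]
        · simp
      · rw [ha, sg_apply, if_neg hi, mul_zero]
    simp only [eichler_apply, Pi.add_apply, Pi.sub_apply, Pi.smul_apply, smul_eq_mul, h1, h2, h3]
    ring) (hfix _ huk hu)
  refine ⟨g, hg, ?_, fun v hv hvz => by rw [hgφ, hfix v hv hvz]⟩
  rw [hgφ]
  -- The image of `z` agrees with `x` up to a multiple of `a`. As it is isotropic and `β(x, a) = x k
  -- = 1`, that multiple is zero.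
  obtain ⟨c, hc⟩ : ∃ c : ℂ, eichler a b z = x + c • a := by
    refine ⟨-(x k.rev - z k.rev) - (beta z b + beta b b / 2 * beta z a), ?_⟩
    rw [eichler_apply, hβa, hzk, hb]
    ext i
    simp only [Pi.add_apply, Pi.sub_apply, Pi.smul_apply, smul_eq_mul]; ring
  have h := eichler_iso haa hab z z
  rw [hc, hz] at h
  simp only [beta_add_left, beta_add_right, beta_smul_left, beta_smul_right, hx,
    beta_comm a x, hβa, hxk, Pi.add_apply, Pi.smul_apply, smul_eq_mul,
    show a k = 0 from (hβa a).symm.trans haa] at h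
  have hc0 : c = 0 := by linear_combination h / 2
  rw [hc, hc0, zero_smul, add_zero]

/-- Eichler transformations with `a` in the span of `e_1, …, e_{ℓ-1}`. -/
theorem exists_eichler_mem_B {y b : Fin (2 * ℓ) → ℂ} (hy : ∀ i, pl ℓ ≤ i → y i = 0)
    (hb : ∀ i, ml ℓ < i → b i = 0) (hbu : b (pl ℓ) = b (ml ℓ)) :
    ∃ g ∈ B ℓ, ∀ x, (SO.mat g).mulVec x = eichler y b x := by
  have hβy : ∀ v : Fin (2 * ℓ) → ℂ, (∀ i, ml ℓ < i → v i = 0) → beta v y = 0 := by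
    intro v hv
    refine Finset.sum_eq_zero fun i _ => ?_
    by_cases hi : ml ℓ < i
    · rw [hv i hi, zero_mul]
    · rw [hy i.rev (not_lt.1 fun h => hi (rev_lt_pl.1 h)), mul_zero]
  have hyy : beta y y = 0 := hβy y fun i hi => hy i (pl_lt_ml.le.trans hi.le)
  have hyb : beta y b = 0 := by rw [beta_comm]; exact hβy b hb
  refine exists_mem_B (eichler y b) (eichler_iso hyy hyb) ?_ ?_
  · intro k i hki
    have h1 : sg k i = 0 := by rw [sg_apply, if_neg hki.ne']
    rw [eichler_apply]
    by_cases hk : ml ℓ < k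
    · simp [h1, hb i (hk.trans hki), hy i (pl_lt_ml.le.trans (hk.trans hki).le)]
    · have h2 : beta (sg k) y = 0 := hβy _ fun j hj => by
        rw [sg_apply, if_neg]; rintro rfl; exact hk hj
      have h3 : beta (sg k) b * y i = 0 := by
        rw [beta_sg_left]
        by_cases hkp : k < pl ℓ
        · rw [hb _ (ml_lt_rev.2 hkp), zero_mul]
        · rw [hy i ((not_lt.1 hkp).trans hki.le), mul_zero]
      simp [h1, h2, h3]
  · refine eichler_fix ?_ ?_
    · rw [beta_uvec, hy _ le_rfl, hy _ pl_lt_ml.le, sub_zero]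
    · rw [beta_uvec, hbu, sub_self]

/-- The torus of `B_{2ℓ-1}`. -/
theorem exists_torus_mem_B {c : Fin (2 * ℓ) → ℂ} (hc : ∀ k, c k * c k.rev = 1)
    (hp : c (pl ℓ) = 1) (hm : c (ml ℓ) = 1) :
    ∃ g ∈ B ℓ, ∀ x, (SO.mat g).mulVec x = fun i => c i * x i := by
  refine exists_mem_B
    { toFun := fun x i => c i * x i
      map_add' := fun x y => by ext i; simp only [Pi.add_apply]; ring
      map_smul' := fun r x => by
        ext i; simp only [Pi.smul_apply, smul_eq_mul, RingHom.id_apply]; ring } ?_ ?_ ?_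
  · intro x y
    refine Finset.sum_congr rfl fun i _ => ?_
    show c i * x i * (c i.rev * y i.rev) = _
    linear_combination (x i * y i.rev) * hc i
  · intro k i hki
    show c i * sg k i = 0
    rw [sg_apply, if_neg hki.ne', mul_zero]
  · ext i
    show c i * uvec ℓ i = uvec ℓ i
    simp only [uvec, Pi.sub_apply, sg_apply]
    split_ifs with h1 h2 h2 <;> simp_all

end Middle
end

/-! ### Words of symbols, and extension by a letter with lead outside the middle. -/

section
variable {ℓ : ℕ}

/-- A symbol `(k, b)` encodes a vector with lowest position `k`: a standard basis vector if `b` is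
`false` and a hat or tilde vector if `b` is `true`. -/
abbrev Sym (ℓ : ℕ) : Type := Fin (2 * ℓ) × Bool

/-- If the vectors `v i` have pairwise different lowest positions and a linear combination of them
vanishes at all positions in an upper set `P`, then so do the coefficients of those `v i` whose
lowest position is in `P`. -/
theorem coeff_eq_zero_of_lead {ι : Type*} [Fintype ι] {n : ℕ} {v : ι → Fin n → ℂ} {ld : ι → Fin n}
    (hinj : Function.Injective ld) (h1 : ∀ i, v i (ld i) = 1) (h0 : ∀ i j, ld i < j → v i j = 0)
    {P : Fin n → Prop} (hP : ∀ i j, i ≤ j → P i → P j) {c : ι → ℂ}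
    (hx : ∀ j, P j → (∑ i, c i • v i) j = 0) (i : ι) (hi : P (ld i)) : c i = 0 := by
  classical
  by_contra hc
  obtain ⟨m, hm, hmax⟩ := Finset.exists_max_image
    (Finset.univ.filter fun i => c i ≠ 0 ∧ P (ld i)) ld ⟨i, by simp [hc, hi]⟩
  simp only [Finset.mem_filter, Finset.mem_univ, true_and] at hm hmax
  have h := hx (ld m) hm.2
  rw [Finset.sum_apply, Finset.sum_eq_single m] at h
  · rw [Pi.smul_apply, h1, smul_eq_mul, mul_one] at h
    exact hm.1 h
  · intro i' _ hne
    rw [Pi.smul_apply, smul_eq_mul]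
    rcases lt_trichotomy (ld i') (ld m) with h | h | h
    · rw [h0 i' _ h, mul_zero]
    · exact absurd (hinj h) hne
    · by_cases hc' : c i' = 0
      · rw [hc', zero_mul]
      · exact absurd (hmax i' ⟨hc', hP _ _ h.le hm.2⟩) (not_le.2 h)
  · simp

theorem linearIndependent_of_lead {ι : Type*} [Fintype ι] {n : ℕ} {v : ι → Fin n → ℂ}
    {ld : ι → Fin n} (hinj : Function.Injective ld) (h1 : ∀ i, v i (ld i) = 1)
    (h0 : ∀ i j, ld i < j → v i j = 0) : LinearIndependent ℂ v := by
  rw [Fintype.linearIndependent_iff]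
  intro c hc i
  exact coeff_eq_zero_of_lead hinj h1 h0 (P := fun _ => True) (fun _ _ _ _ => trivial)
    (fun j _ => by rw [hc]; rfl) i trivial

theorem exists_lead {n : ℕ} {x : Fin n → ℂ} (hx : x ≠ 0) :
    ∃ k, x k ≠ 0 ∧ ∀ j, k < j → x j = 0 := by
  classical
  obtain ⟨i, hi⟩ := Function.ne_iff.1 hx
  obtain ⟨m, hm, hmax⟩ := Finset.exists_max_image
    (Finset.univ.filter fun i => x i ≠ 0) id ⟨i, by simpa using hi⟩
  simp only [Finset.mem_filter, Finset.mem_univ, true_and, id] at hm hmax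
  exact ⟨m, hm, fun j hj => by_contra fun h => absurd (hmax j h) (not_le.2 hj)⟩

variable [NeZero ℓ]

/-- The position of the second summand of a tilde (`true`) or hat (`false`) vector. -/
def tp (ℓ : ℕ) [NeZero ℓ] (t : Bool) : Fin (2 * ℓ) := if t then pl ℓ else ml ℓ

/-- The vector encoded by a symbol. -/
def vec (t : Bool) (s : Sym ℓ) : Fin (2 * ℓ) → ℂ :=
  if s.2 then sg s.1 + sg (tp ℓ t) else sg s.1

theorem vec_true (t : Bool) (k : Fin (2 * ℓ)) : vec t (k, true) = sg k + sg (tp ℓ t) := rfl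

theorem vec_false (t : Bool) (k : Fin (2 * ℓ)) : vec t (k, false) = sg k := rfl

/-- The relation between two symbols, the first one preceding the second one, in a word encoding a
flag in standard form. -/
def Ok (s s' : Sym ℓ) : Prop :=
  s.1 ≠ s'.1 ∧ s.1 ≠ s'.1.rev ∧
    (s'.2 = true → s.1 ≠ pl ℓ ∧ s.1 ≠ ml ℓ ∧ (s.2 = true → s'.1 < s.1))

/-- The words of symbols that encode partial flags in standard form. -/
structure Good (w : List (Sym ℓ)) : Prop where
  marked : ∀ s ∈ w, s.2 = true → ml ℓ < s.1
  pair : w.Pairwise Ok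

/-- Whether the marked symbols of the word encode tilde vectors. -/
def tl (w : List (Sym ℓ)) : Bool := decide ((pl ℓ, false) ∈ w)

theorem tl_eq_true {w : List (Sym ℓ)} : tl w = true ↔ (pl ℓ, false) ∈ w := by simp [tl]

theorem tl_eq_false {w : List (Sym ℓ)} : tl w = false ↔ (pl ℓ, false) ∉ w := by simp [tl]

theorem good_append {w : List (Sym ℓ)} {s : Sym ℓ} :
    Good (w ++ [s]) ↔ Good w ∧ (s.2 = true → ml ℓ < s.1) ∧ ∀ s' ∈ w, Ok s' s := by
  constructor
  · intro h
    have hp := List.pairwise_append.1 h.pair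
    exact ⟨⟨fun s' hs' => h.marked s' (by simp [hs']), hp.1⟩, h.marked s (by simp),
      fun s' hs' => hp.2.2 s' hs' s (by simp)⟩
  · rintro ⟨h, h1, h2⟩
    refine ⟨fun s' hs' => ?_, List.pairwise_append.2 ⟨h.pair, by simp, fun s' hs' b hb => ?_⟩⟩
    · rcases List.mem_append.1 hs' with h' | h'
      · exact h.marked s' h'
      · rw [List.mem_singleton.1 h']; exact h1
    · rw [List.mem_singleton.1 hb]; exact h2 s' hs'

theorem tp_le (t : Bool) : tp ℓ t ≤ ml ℓ := by
  cases t
  · exact le_rfl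
  · exact pl_lt_ml.le

theorem tp_cases (t : Bool) : tp ℓ t = pl ℓ ∨ tp ℓ t = ml ℓ := by
  cases t
  · exact Or.inr rfl
  · exact Or.inl rfl

theorem vec_apply (t : Bool) (s : Sym ℓ) (i : Fin (2 * ℓ)) :
    vec t s i = (if i = s.1 then 1 else 0) + if s.2 = true ∧ i = tp ℓ t then 1 else 0 := by
  rcases s with ⟨k, _ | _⟩
  · simp [vec_false, sg_apply]
  · simp [vec_true, sg_apply]

theorem beta_vec (t : Bool) (s : Sym ℓ) (x : Fin (2 * ℓ) → ℂ) :
    beta x (vec t s) = x s.1.rev + if s.2 = true then x (tp ℓ t).rev else 0 := by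
  rcases s with ⟨k, _ | _⟩
  · simp [vec_false, beta_sg_right]
  · simp [vec_true, beta_sg_right, beta_add_right]

theorem vec_eq_zero {t : Bool} {s : Sym ℓ} {i : Fin (2 * ℓ)} (h1 : i ≠ s.1)
    (h2 : s.2 = true → i ≠ tp ℓ t) : vec t s i = 0 := by
  rw [vec_apply, if_neg h1, if_neg (fun h => h2 h.1 h.2), add_zero]

theorem vec_self {t : Bool} {s : Sym ℓ} (h : s.2 = true → ml ℓ < s.1) : vec t s s.1 = 1 := by
  rw [vec_apply, if_pos rfl, if_neg (fun h' => (((tp_le t).trans_lt (h h'.1)).ne' h'.2)), add_zero]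

theorem vec_gt {t : Bool} {s : Sym ℓ} (h : s.2 = true → ml ℓ < s.1) {j : Fin (2 * ℓ)}
    (hj : s.1 < j) : vec t s j = 0 :=
  vec_eq_zero hj.ne' fun hs => ((tp_le t).trans_lt ((h hs).trans hj)).ne'

/-- A marked letter never follows `e_{±ℓ}`, so the middle summand of a later vector avoids the
earlier leads too. The other direction fails, as a hat vector may precede `e_{-ℓ}`; leads are
therefore cleared in the order of the word. -/
theorem Ok.vec_eq_zero {t : Bool} {s s' : Sym ℓ} (h : Ok s s') : vec t s' s.1 = 0 := by
  refine OrthFlags.vec_eq_zero h.1 fun hs => ?_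
  rcases tp_cases (ℓ := ℓ) t with h' | h' <;> rw [h']
  exacts [(h.2.2 hs).1, (h.2.2 hs).2.1]

/-- The span of the vectors of a word. -/
def wspan (t : Bool) (w : List (Sym ℓ)) : Submodule ℂ (Fin (2 * ℓ) → ℂ) :=
  Submodule.span ℂ (vec t '' {s | s ∈ w})

theorem vec_mem_wspan {t : Bool} {w : List (Sym ℓ)} {s : Sym ℓ} (hs : s ∈ w) :
    vec t s ∈ wspan t w := Submodule.subset_span ⟨s, hs, rfl⟩

theorem wspan_mono {t : Bool} {w w' : List (Sym ℓ)} (h : w ⊆ w') : wspan t w ≤ wspan t w' :=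
  Submodule.span_mono (Set.image_mono h)

theorem Good.linearIndependent {w : List (Sym ℓ)} (hw : Good w) (t : Bool) :
    LinearIndependent ℂ fun i => vec t (w.get i) := by
  have hm := fun i => hw.marked (w.get i) (List.get_mem _ _)
  have hp := List.pairwise_iff_get.1 hw.pair
  refine linearIndependent_of_lead (ld := fun i => (w.get i).1) ?_ (fun i => vec_self (hm i))
    (fun i j hj => vec_gt (hm i) hj)
  intro i j hij
  rcases lt_trichotomy i j with h | h | h
  · exact absurd hij (hp i j h).1
  · exact h
  · exact absurd hij.symm (hp j i h).1

theorem Good.finrank_wspan {w : List (Sym ℓ)} (hw : Good w) (t : Bool) :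
    Module.finrank ℂ (wspan t w) = w.length := by
  have h := finrank_span_eq_card (hw.linearIndependent t)
  rw [Fintype.card_fin] at h
  have hr : vec t '' {s | s ∈ w} = Set.range fun i => vec t (w.get i) := by
    ext v
    constructor
    · rintro ⟨s, hs, rfl⟩
      obtain ⟨i, rfl⟩ := List.get_of_mem hs
      exact ⟨i, rfl⟩
    · rintro ⟨i, rfl⟩
      exact ⟨_, List.get_mem _ _, rfl⟩
  rw [← h, wspan, hr]

/-- Clearing the positions of the symbols of a word. -/
theorem Good.exists_normalized {w : List (Sym ℓ)} (hw : Good w) (t : Bool)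
    (x : Fin (2 * ℓ) → ℂ) : ∃ y ∈ wspan t w, ∀ s ∈ w, (x + y) s.1 = 0 := by
  induction w using List.reverseRecOn with
  | nil => exact ⟨0, Submodule.zero_mem _, by simp⟩
  | append_singleton w s ih =>
    obtain ⟨hw', hs, hok⟩ := good_append.1 hw
    obtain ⟨y, hy, hy0⟩ := ih hw'
    refine ⟨y - (x + y) s.1 • vec t s, Submodule.sub_mem _ (wspan_mono (by simp) hy)
      (Submodule.smul_mem _ _ (vec_mem_wspan (by simp))), fun s' hs' => ?_⟩
    rw [← add_sub_assoc, Pi.sub_apply, Pi.smul_apply, smul_eq_mul]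
    rcases List.mem_append.1 hs' with h | h
    · rw [hy0 s' h, (hok s' h).vec_eq_zero, mul_zero, sub_zero]
    · rw [List.mem_singleton.1 h, vec_self hs, mul_one, sub_self]

/-- The conclusion of the inductive step: up to the action of `B_{2ℓ-1}`, a word for the first
subspaces of a flag extends to the next subspace `W`. -/
def Extends (w : List (Sym ℓ)) (W : Submodule ℂ (Fin (2 * ℓ) → ℂ)) : Prop :=
  ∃ g ∈ B ℓ, ∃ s, Good (w ++ [s]) ∧
    (∀ s' ∈ w, ∃ c : ℂ, c ≠ 0 ∧
      (SO.mat g).mulVec (vec (tl (w ++ [s])) s') = c • vec (tl w) s') ∧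
    (SO.mat g).mulVec (vec (tl (w ++ [s])) s) ∈ W

theorem tl_append {w : List (Sym ℓ)} {s : Sym ℓ} (hs : s ≠ (pl ℓ, false)) :
    tl (w ++ [s]) = tl w := by
  simp [tl, hs.symm]

section Step
variable {w : List (Sym ℓ)} {W : Submodule ℂ (Fin (2 * ℓ) → ℂ)}

/-- A vector orthogonal to `u` with non-middle lead `k` is, after scaling, the image of the basis
vector at `k`. The earlier vectors are orthogonal to both and vanish at `k`, so they stay fixed. -/
theorem extends_of_lead (hw : Good w) (hiso : ∀ x ∈ W, ∀ y ∈ W, beta x y = 0)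
    (hwW : ∀ s ∈ w, vec (tl w) s ∈ W) {x : Fin (2 * ℓ) → ℂ} (hx : x ∈ W) {k : Fin (2 * ℓ)}
    (hk : x k ≠ 0) (hk0 : ∀ j, k < j → x j = 0) (hp : k ≠ pl ℓ) (hm : k ≠ ml ℓ)
    (hu : beta (uvec ℓ) x = 0) (hkw : ∀ s ∈ w, k ≠ s.1 ∧ k ≠ s.1.rev) : Extends w W := by
  have hxW : (x k)⁻¹ • x ∈ W := W.smul_mem _ hx
  obtain ⟨g, hg, hgz, hgv⟩ := exists_move_lead hp hm (z := sg k) (x := (x k)⁻¹ • x)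
    (by rw [beta_sg_left, sg_apply, if_neg (rev_ne k)]) (hiso _ hxW _ hxW)
    (by simp [sg_apply]) (by simp [hk]) (fun j hj => by rw [sg_apply, if_neg hj.ne'])
    (fun j hj => by simp [hk0 j hj])
    (by rw [beta_smul_right, hu, mul_zero, beta_sg_right, uvec]
        simp [sg_apply, rev_eq_pl, rev_eq_ml, hp, hm])
  have ht : tl (w ++ [(k, false)]) = tl w := tl_append (by simp [hp])
  refine ⟨g, hg, (k, false), good_append.2 ⟨hw, by simp, fun s hs => ?_⟩, fun s hs => ?_, ?_⟩
  · exact ⟨(hkw s hs).1.symm, fun h => (hkw s hs).2 (by rw [h, Fin.rev_rev]), by simp⟩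
  · have htp : k ≠ tp ℓ (tl w) ∧ k.rev ≠ tp ℓ (tl w) := by
      rcases tp_cases (ℓ := ℓ) (tl w) with h | h <;> simp [h, rev_eq_pl, rev_eq_ml, hp, hm]
    refine ⟨1, one_ne_zero, ?_⟩
    rw [ht, one_smul]
    refine hgv _ (vec_eq_zero (hkw s hs).1 fun _ => htp.1) ?_
    rw [beta_sg_right, hiso _ (hwW s hs) _ hxW]
    exact vec_eq_zero (fun h => (hkw s hs).2 (by rw [← h, Fin.rev_rev])) fun _ => htp.2
  · rw [ht, vec_false, hgz]; exact hxW

/-- Two numbers need normalizing: scaling makes the pairing with `u` equal to that of a hat vector,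
and then a torus element makes the leading coefficient `1`. After that the hat vector can be moved
as in `extends_of_lead`. -/
theorem extends_of_lead_hat (hw : Good w) (hiso : ∀ x ∈ W, ∀ y ∈ W, beta x y = 0)
    (hwW : ∀ s ∈ w, vec (tl w) s ∈ W) (hwp : ∀ s ∈ w, s.1 ≠ pl ℓ ∧ s.1 ≠ ml ℓ)
    {x : Fin (2 * ℓ) → ℂ} (hx : x ∈ W) {k : Fin (2 * ℓ)}
    (hk : x k ≠ 0) (hk0 : ∀ j, k < j → x j = 0) (hkm : ml ℓ < k)
    (hu : beta (uvec ℓ) x ≠ 0) (hkw : ∀ s ∈ w, k ≠ s.1 ∧ k ≠ s.1.rev)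
    (hmk : ∀ s ∈ w, s.2 = true → k < s.1) : Extends w W := by
  have hm : k ≠ ml ℓ := hkm.ne'
  have hp : k ≠ pl ℓ := (pl_lt_ml.trans hkm).ne'
  have htw : tl w = false := tl_eq_false.2 fun h => (hwp _ h).1 rfl
  have ht : tl (w ++ [(k, true)]) = false := by rw [tl_append (by simp), htw]
  set x₁ := (beta (uvec ℓ) x)⁻¹ • x with hx₁
  have hx₁W : x₁ ∈ W := W.smul_mem _ hx
  set d := x₁ k with hd
  have hd0 : d ≠ 0 := by simp [hd, hx₁, hk, hu]
  -- This torus element only rescales the positions `k` and `k.rev`, where all vectors of `w`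
  -- vanish.
  set c : Fin (2 * ℓ) → ℂ := fun i => if i = k then d else if i = k.rev then d⁻¹ else 1 with hc
  have hkr := rev_ne k
  have hcp : ∀ i, i ≠ k → i ≠ k.rev → c i = 1 := fun i h1 h2 => by simp [hc, h1, h2]
  have hpr : pl ℓ ≠ k.rev := fun h => hm (rev_eq_pl.1 h.symm)
  have hmr : ml ℓ ≠ k.rev := fun h => hp (rev_eq_ml.1 h.symm)
  obtain ⟨T, hT, hTx⟩ := exists_torus_mem_B (c := c) (fun i => by
    by_cases h1 : i = k
    · subst h1; simp [hc, hkr, hd0]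
    · by_cases h2 : i = k.rev
      · subst h2; simp [hc, hkr, hd0]
      · rw [hcp i h1 h2, hcp i.rev (fun h => h2 (by rw [← h, Fin.rev_rev]))
          (fun h => h1 (Fin.rev_inj.1 h)), one_mul])
    (hcp _ hp.symm hpr) (hcp _ hm.symm hmr)
  have hci : ∀ i, c i ≠ 0 := fun i => by
    by_cases h1 : i = k
    · simp [hc, h1, hd0]
    · by_cases h2 : i = k.rev
      · simp [hc, h2, hkr, hd0]
      · rw [hcp i h1 h2]; exact one_ne_zero
  set x₂ : Fin (2 * ℓ) → ℂ := fun i => (c i)⁻¹ * x₁ i with hx₂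
  have hTx₂ : (SO.mat T).mulVec x₂ = x₁ := by
    rw [hTx]; ext i; rw [hx₂]; field_simp [hci i]
  have hTβ : ∀ y z, beta ((SO.mat T).mulVec y) ((SO.mat T).mulVec z) = beta y z := T.2
  have hTw : ∀ s ∈ w, (SO.mat T).mulVec (vec false s) = vec false s := by
    intro s hs
    rw [hTx]
    ext i
    by_cases h1 : i = k
    · rw [vec_eq_zero (by rw [h1]; exact (hkw s hs).1) (fun _ => by rw [h1]; exact hm), mul_zero]
    · by_cases h2 : i = k.rev
      · rw [vec_eq_zero (by rw [h2]; exact fun h => (hkw s hs).2 (by rw [← h, Fin.rev_rev]))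
          (fun _ => by rw [h2]; exact hmr.symm), mul_zero]
      · rw [hcp i h1 h2, one_mul]
  have hux₁ : beta (uvec ℓ) x₁ = 1 := by rw [hx₁, beta_smul_right, inv_mul_cancel₀ hu]
  obtain ⟨g, hg, hgz, hgv⟩ := exists_move_lead hp hm (z := vec false (k, true)) (x := x₂)
    (by
      rw [beta_vec, vec_eq_zero hkr fun _ => hmr.symm]
      simp only [if_true]
      rw [vec_eq_zero, add_zero]
      · rw [show (tp ℓ false).rev = pl ℓ from rev_ml]; exact hp.symm
      · intro _; exact rev_ne _)
    (by rw [← hTβ, hTx₂]; exact hiso _ hx₁W _ hx₁W)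
    (vec_self fun _ => hkm) (by simp [hx₂, hc, hd0, ← hd])
    (fun j hj => vec_gt (fun _ => hkm) hj)
    (fun j hj => by simp [hx₂, hx₁, hk0 j hj])
    (by
      have h1 : beta (uvec ℓ) x₂ = 1 := by
        rw [← hTβ, hTx₂, mem_B_uvec hT, hux₁]
      rw [h1, beta_vec, show (tp ℓ false).rev = pl ℓ from rev_ml]
      simp [uvec, sg_apply, pl_ne_ml, hmr.symm, hpr.symm])
  refine ⟨T * g, (B ℓ).mul_mem hT hg, (k, true), good_append.2 ⟨hw, fun _ => hkm, fun s hs => ?_⟩,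
    fun s hs => ⟨1, one_ne_zero, ?_⟩, ?_⟩
  · exact ⟨(hkw s hs).1.symm, fun h => (hkw s hs).2 (by rw [h, Fin.rev_rev]),
      fun _ => ⟨(hwp s hs).1, (hwp s hs).2, hmk s hs⟩⟩
  · rw [ht, htw, SO.mat_mul, ← Matrix.mulVec_mulVec, hgv, hTw s hs, one_smul]
    · exact vec_eq_zero (hkw s hs).1 fun _ => hm
    · rw [← hTβ _ x₂, hTw s hs, hTx₂, hiso _ (htw ▸ hwW s hs) _ hx₁W, beta_vec,
        show (tp ℓ false).rev = pl ℓ from rev_ml,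
        vec_eq_zero (fun h => (hkw s hs).2 (by rw [← h, Fin.rev_rev])) (fun _ => hmr.symm),
        vec_eq_zero (hwp s hs).1.symm (fun _ => pl_ne_ml)]
      simp
  · rw [ht, SO.mat_mul, ← Matrix.mulVec_mulVec, hgz, hTx₂]; exact hx₁W

end Step
end

/-! ### Middle leads, the case distinction, and a word in every orbit. -/

section
variable {ℓ : ℕ}

theorem smul_V (g : SO (2 * ℓ)) (F : IsoFlag ℓ) (m : Fin (ℓ - 1)) :
    (g • F).V m = (F.V m).map (SO.mat g).mulVecLin := rfl

theorem smul_mem_smul_V {g : SO (2 * ℓ)} {F : IsoFlag ℓ} {m : Fin (ℓ - 1)}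
    {x : Fin (2 * ℓ) → ℂ} (hx : x ∈ F.V m) : (SO.mat g).mulVec x ∈ (g • F).V m :=
  Submodule.mem_map_of_mem (f := (SO.mat g).mulVecLin) hx

variable [NeZero ℓ]

theorem Good.eq_or_ok {w : List (Sym ℓ)} (hw : Good w) {s s' : Sym ℓ} (hs : s ∈ w) (hs' : s' ∈ w) :
    s = s' ∨ Ok s s' ∨ Ok s' s := by
  obtain ⟨i, rfl⟩ := List.get_of_mem hs
  obtain ⟨j, rfl⟩ := List.get_of_mem hs'
  have hp := List.pairwise_iff_get.1 hw.pair
  rcases lt_trichotomy i j with h | rfl | h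
  · exact Or.inr (Or.inl (hp i j h))
  · exact Or.inl rfl
  · exact Or.inr (Or.inr (hp j i h))

theorem Good.eq_of_fst_eq {w : List (Sym ℓ)} (hw : Good w) {s s' : Sym ℓ} (hs : s ∈ w)
    (hs' : s' ∈ w) (h : s.1 = s'.1) : s = s' := by
  rcases hw.eq_or_ok hs hs' with h' | h' | h'
  exacts [h', absurd h h'.1, absurd h.symm h'.1]

theorem Good.ne_rev {w : List (Sym ℓ)} (hw : Good w) {s s' : Sym ℓ} (hs : s ∈ w) (hs' : s' ∈ w) :
    s.1 ≠ s'.1.rev := by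
  rcases hw.eq_or_ok hs hs' with h' | h' | h'
  · subst h'; exact (rev_ne _).symm
  · exact h'.2.1
  · exact fun h => h'.2.1 (by rw [h, Fin.rev_rev])

section Step
variable {w : List (Sym ℓ)} {W : Submodule ℂ (Fin (2 * ℓ) → ℂ)}

theorem tl_of_ne (hwp : ∀ s ∈ w, s.1 ≠ pl ℓ ∧ s.1 ≠ ml ℓ) : tl w = false :=
  tl_eq_false.2 fun h => (hwp _ h).1 rfl

/-- An Eichler transformation along `y = x - e_{-ℓ}` sends `e_{-ℓ}` to `x`; its second vector `b` is
adjusted so that every earlier vector is fixed. -/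
theorem extends_of_ml (hw : Good w) (hiso : ∀ x ∈ W, ∀ y ∈ W, beta x y = 0)
    (hwW : ∀ s ∈ w, vec (tl w) s ∈ W) (hwp : ∀ s ∈ w, s.1 ≠ pl ℓ ∧ s.1 ≠ ml ℓ)
    {x : Fin (2 * ℓ) → ℂ} (hx : x ∈ W) (hp : x (pl ℓ) = 0) (hm : x (ml ℓ) = 1)
    (h0 : ∀ j, ml ℓ < j → x j = 0) : Extends w W := by
  have htw := tl_of_ne hwp
  have ht : tl (w ++ [(ml ℓ, false)]) = tl w := tl_append (by simp [pl_ne_ml.symm])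
  set y := x - sg (ml ℓ) with hy
  -- The equal middle entries keep `u` fixed, and their value `-1` gives `e_{-ℓ} ↦ e_{-ℓ} + y`. The
  -- entries `1` opposite to the marked leads make `b` orthogonal to the hat vectors.
  set b : Fin (2 * ℓ) → ℂ :=
    fun i => if i = pl ℓ ∨ i = ml ℓ then -1 else if (i.rev, true) ∈ w then 1 else 0 with hb
  have hbp : b (pl ℓ) = -1 := by simp [hb]
  have hbm : b (ml ℓ) = -1 := by simp [hb]
  have hyp : y (pl ℓ) = 0 := by simp [hy, hp, sg_apply, pl_ne_ml]
  obtain ⟨g, hg, hgx⟩ := exists_eichler_mem_B (y := y) (b := b)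
    (fun i hi => by
      rcases lt_or_ge (ml ℓ) i with h | h
      · simp [hy, h0 i h, sg_apply, h.ne']
      · rcases le_ml_iff.1 h with h | rfl | rfl
        · exact absurd h (not_lt.2 hi)
        · exact hyp
        · simp [hy, hm, sg_apply])
    (fun i hi => by
      have h1 : i ≠ pl ℓ := (pl_lt_ml.trans hi).ne'
      have h2 : (i.rev, true) ∉ w := fun h =>
        absurd (ml_lt_rev.1 (hw.marked _ h rfl)) (not_lt.2 (pl_lt_ml.trans hi).le)
      simp [hb, h1, hi.ne', h2])
    (hbp.trans hbm.symm)
  refine ⟨g, hg, (ml ℓ, false), good_append.2 ⟨hw, by simp, fun s hs => ?_⟩,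
    fun s hs => ⟨1, one_ne_zero, ?_⟩, ?_⟩
  · exact ⟨(hwp s hs).2, by rw [rev_ml]; exact (hwp s hs).1, by simp⟩
  · have h1 : s.1.rev ≠ pl ℓ := fun h => (hwp s hs).2 (rev_eq_pl.1 h)
    have h2 : s.1.rev ≠ ml ℓ := fun h => (hwp s hs).1 (rev_eq_ml.1 h)
    have hxs := hiso _ hx _ (hwW s hs)
    rw [htw, beta_vec, show (tp ℓ false).rev = pl ℓ from rev_ml, hp, ite_self, add_zero] at hxs
    rw [ht, one_smul, hgx, htw]
    refine eichler_fix ?_ ?_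
    · rw [beta_comm, beta_vec, show (tp ℓ false).rev = pl ℓ from rev_ml, hyp, ite_self, add_zero]
      simp [hy, hxs, sg_apply, h2]
    · rw [beta_comm, beta_vec, show (tp ℓ false).rev = pl ℓ from rev_ml, hbp]
      rcases s with ⟨k, _ | _⟩
      · have : (k, true) ∉ w := fun h => by simpa using hw.eq_of_fst_eq h hs rfl
        simp only at h1 h2
        simp [hb, h1, h2, this]
      · simp only at h1 h2
        simp [hb, h1, h2, hs]
  · have : (SO.mat g).mulVec (sg (ml ℓ)) = x := by
      rw [hgx, eichler_apply, beta_sg_left, beta_sg_left, rev_ml, hyp, hbp, hy]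
      simp
    rw [vec_false, this]; exact hx

/-- Appending `e_ℓ` changes the kind of all marked letters. Orthogonality of `x` to the hat vectors
gives `y` the coordinate `-1` opposite to each marked lead, so the Eichler transformation adds `b =
-e_ℓ - e_{-ℓ}` exactly once and trades `e_ℓ` for `-e_{-ℓ}`. -/
theorem extends_of_pl (hw : Good w) (hiso : ∀ x ∈ W, ∀ y ∈ W, beta x y = 0)
    (hwW : ∀ s ∈ w, vec (tl w) s ∈ W) (hwp : ∀ s ∈ w, s.1 ≠ pl ℓ ∧ s.1 ≠ ml ℓ)
    {x : Fin (2 * ℓ) → ℂ} (hx : x ∈ W) (hp : x (pl ℓ) = 1) (hm : x (ml ℓ) = 0)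
    (h0 : ∀ j, ml ℓ < j → x j = 0) : Extends w W := by
  have htw := tl_of_ne hwp
  have ht : tl (w ++ [(pl ℓ, false)]) = true := tl_eq_true.2 (by simp)
  set y := x - sg (pl ℓ) with hy
  set b : Fin (2 * ℓ) → ℂ := -sg (pl ℓ) - sg (ml ℓ) with hb
  -- Sign changes at the marked leads turn a tilde vector into `e_ℓ` minus a basis vector, which the
  -- Eichler transformation then sends to minus a hat vector.
  set c : Fin (2 * ℓ) → ℂ :=
    fun i => if (i, true) ∈ w ∨ (i.rev, true) ∈ w then -1 else 1 with hc
  have hbp : b (pl ℓ) = -1 := by simp [hb, sg_apply, pl_ne_ml]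
  have hbm : b (ml ℓ) = -1 := by simp [hb, sg_apply, pl_ne_ml.symm]
  have hb0 : ∀ i, i ≠ pl ℓ → i ≠ ml ℓ → b i = 0 := fun i h1 h2 => by simp [hb, sg_apply, h1, h2]
  have hbb : beta b b = 2 := by
    rw [hb, beta_sub_right, beta_sg_right, rev_ml, ← hb, hbp, beta_comm, ← neg_one_smul ℂ (sg _),
      beta_smul_left, beta_sg_left, rev_pl, hbm]
    norm_num
  have hym : y (ml ℓ) = 0 := by simp [hy, hm, sg_apply, pl_ne_ml.symm]
  have hpw : (pl ℓ, true) ∉ w := fun h => (hwp _ h).1 rfl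
  have hmw : (ml ℓ, true) ∉ w := fun h => (hwp _ h).2 rfl
  obtain ⟨T, hT, hTx⟩ := exists_torus_mem_B (c := c)
    (fun i => by
      rw [hc]
      simp only [Fin.rev_rev, or_comm (a := (i.rev, true) ∈ w)]
      split_ifs <;> norm_num)
    (by simp [hc, rev_pl, hpw, hmw]) (by simp [hc, rev_ml, hpw, hmw])
  have hTsg : ∀ i, (SO.mat T).mulVec (sg i) = c i • sg i := fun i => by
    rw [hTx]
    ext j
    simp only [sg_apply, Pi.smul_apply, smul_eq_mul]
    split_ifs with h
    · rw [h]
    · simp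
  have hTp : (SO.mat T).mulVec (sg (pl ℓ)) = sg (pl ℓ) := by
    rw [hTsg]; simp [hc, rev_pl, hpw, hmw]
  obtain ⟨g, hg, hgx⟩ := exists_eichler_mem_B (y := y) (b := b)
    (fun i hi => by
      rcases lt_or_ge (ml ℓ) i with h | h
      · simp [hy, h0 i h, sg_apply, (pl_lt_ml.trans h).ne']
      · rcases le_ml_iff.1 h with h | rfl | rfl
        · exact absurd h (not_lt.2 hi)
        · simp [hy, hp, sg_apply]
        · exact hym)
    (fun i hi => hb0 i (pl_lt_ml.trans hi).ne' hi.ne')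
    (hbp.trans hbm.symm)
  have hxs : ∀ s ∈ w, x s.1.rev + (if s.2 = true then 1 else 0) = 0 := fun s hs => by
    have := hiso _ hx _ (hwW s hs)
    rwa [htw, beta_vec, show (tp ℓ false).rev = pl ℓ from rev_ml, hp] at this
  refine ⟨g * T, (B ℓ).mul_mem hg hT, (pl ℓ, false), good_append.2 ⟨hw, by simp, fun s hs => ?_⟩,
    fun s hs => ?_, ?_⟩
  · exact ⟨(hwp s hs).1, by rw [rev_pl]; exact (hwp s hs).2, by simp⟩
  · have h1 : s.1.rev ≠ pl ℓ := fun h => (hwp s hs).2 (rev_eq_pl.1 h)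
    have h2 : s.1.rev ≠ ml ℓ := fun h => (hwp s hs).1 (rev_eq_ml.1 h)
    have hyx : y s.1.rev = x s.1.rev := by simp [hy, sg_apply, h1]
    have hys := hyx ▸ hxs s hs
    rw [ht, htw, SO.mat_mul, ← Matrix.mulVec_mulVec]
    rcases s with ⟨k, _ | _⟩
    · refine ⟨1, one_ne_zero, ?_⟩
      have hk1 : (k, true) ∉ w := fun h => by simpa using hw.eq_of_fst_eq h hs rfl
      have hk2 : (k.rev, true) ∉ w := fun h => hw.ne_rev h hs rfl
      have hck : c k = 1 := by simp [hc, hk1, hk2]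
      rw [vec_false, vec_false, hTsg, hck, one_smul, hgx]
      refine eichler_fix ?_ ?_
      · rw [beta_sg_left]; simpa using hys
      · rw [beta_sg_left, hb0 _ h1 h2]
    -- The tilde vector goes to minus the hat vector with the same lead. The coefficient of `y` is
    -- zero, since `β(b, b) / 2 = 1` cancels the pairing `-1` with `b`.
    · refine ⟨-1, by norm_num, ?_⟩
      have hck : c k = -1 := by simp [hc, hs]
      have hyk : y k.rev = -1 := by
        simp only [if_true] at hys
        linear_combination hys
      rw [vec_true, vec_true, Matrix.mulVec_add, hTsg, hck, show tp ℓ true = pl ℓ from rfl, hTp,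
        hgx, eichler_apply]
      simp only [beta_add_left, beta_smul_left, beta_sg_left, rev_pl, hym, hbm, hyk, hbb,
        hb0 _ h1 h2]
      rw [hb, show tp ℓ false = ml ℓ from rfl]
      ext i
      simp only [Pi.add_apply, Pi.sub_apply, Pi.smul_apply, Pi.neg_apply, smul_eq_mul]
      ring
  · have : (SO.mat (g * T)).mulVec (sg (pl ℓ)) = x := by
      rw [SO.mat_mul, ← Matrix.mulVec_mulVec, hTp, hgx, eichler_apply, beta_sg_left, beta_sg_left,
        rev_pl, hym, hbm, hy]
      simp
    rw [vec_false, this]; exact hx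

theorem exists_extends (hw : Good w) (hiso : ∀ x ∈ W, ∀ y ∈ W, beta x y = 0)
    (hwW : ∀ s ∈ w, vec (tl w) s ∈ W) (hne : ¬ W ≤ wspan (tl w) w) : Extends w W := by
  obtain ⟨x₀, hx₀, hx₀w⟩ := SetLike.not_le_iff_exists.1 hne
  -- After this correction the lead of `x` is a position not yet used.
  obtain ⟨y, hy, hxy⟩ := hw.exists_normalized (tl w) x₀
  have hle : wspan (tl w) w ≤ W := Submodule.span_le.2 (by rintro _ ⟨s, hs, rfl⟩; exact hwW s hs)
  have hx : x₀ + y ∈ W := W.add_mem hx₀ (hle hy)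
  have hx0 : x₀ + y ≠ 0 := fun h => hx₀w (by
    rw [eq_neg_of_add_eq_zero_left h]; exact Submodule.neg_mem _ hy)
  generalize x₀ + y = x at hxy hx hx0
  obtain ⟨k, hk, hk0⟩ := exists_lead hx0
  have hxs : ∀ s ∈ w, x s.1.rev + (if s.2 = true then x (tp ℓ (tl w)).rev else 0) = 0 :=
    fun s hs => by rw [← beta_vec]; exact hiso _ hx _ (hwW s hs)
  have hks : ∀ s ∈ w, k ≠ s.1 := fun s hs h => hk (by rw [h]; exact hxy s hs)
  -- the case of an isotropic vector with vanishing middle coordinates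
  have hzero : x (pl ℓ) = 0 → x (ml ℓ) = 0 → Extends w W := by
    intro hp hm
    refine extends_of_lead hw hiso hwW hx hk hk0 (fun h => hk (h ▸ hp)) (fun h => hk (h ▸ hm))
      (by rw [beta_uvec, hp, hm, sub_zero]) fun s hs => ⟨hks s hs, fun h => hk ?_⟩
    have h2 := hxs s hs
    have h3 : x (tp ℓ (tl w)).rev = 0 := by
      rcases tp_cases (ℓ := ℓ) (tl w) with h | h <;> rw [h]
      · rw [rev_pl, hm]
      · rw [rev_ml, hp]
    rw [h3, ite_self, add_zero] at h2
    rw [h, h2]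
  -- If `e_ℓ` or `e_{-ℓ}` is already a letter, one middle coordinate of `x` vanishes by
  -- normalization and the other one by orthogonality.
  by_cases hused : ∃ s ∈ w, s.1 = pl ℓ ∨ s.1 = ml ℓ
  · obtain ⟨s, hs, hspm⟩ := hused
    have hs2 : s.2 ≠ true := fun h => by
      have := hw.marked s hs h
      rcases hspm with h' | h'
      · exact absurd (h' ▸ this) (not_lt.2 pl_lt_ml.le)
      · exact absurd (h' ▸ this) (lt_irrefl _)
    have h1 := hxy s hs
    have h2 := hxs s hs
    rw [if_neg hs2, add_zero] at h2
    rcases hspm with h | h <;> rw [h] at h1 h2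
    · rw [rev_pl] at h2; exact hzero h1 h2
    · rw [rev_ml] at h2; exact hzero h2 h1
  push Not at hused
  have htw := tl_of_ne hused
  rw [htw, show (tp ℓ false).rev = pl ℓ from rev_ml] at hxs
  rcases lt_or_ge (ml ℓ) k with hkm | hkm
  · have hkp : pl ℓ < k := pl_lt_ml.trans hkm
    have hkw : ∀ s ∈ w, k ≠ s.1 ∧ k ≠ s.1.rev := fun s hs => by
      refine ⟨hks s hs, fun h => ?_⟩
      by_cases hs2 : s.2 = true
      · have h3 : s.1.rev < pl ℓ := rev_lt_pl.2 (hw.marked s hs hs2)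
        exact absurd (h ▸ h3) (not_lt.2 hkp.le)
      · have h2 := hxs s hs
        rw [if_neg hs2, add_zero, ← h] at h2
        exact hk h2
    by_cases hu : beta (uvec ℓ) x = 0
    · exact extends_of_lead hw hiso hwW hx hk hk0 hkp.ne' hkm.ne' hu hkw
    by_cases hmk : ∀ s ∈ w, s.2 = true → k < s.1
    · exact extends_of_lead_hat hw hiso hwW hused hx hk hk0 hkm hu hkw hmk
    push Not at hmk
    obtain ⟨s, hs, hs2, hsk⟩ := hmk
    have hsk' : s.1 < k := lt_of_le_of_ne hsk (hks s hs).symm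
    have hv0 : ∀ j, s.1 < j → vec false s j = 0 := fun j hj => vec_gt (hw.marked s hs) hj
    -- The earlier hat vector `s` has a smaller lead and pairs to `1` with `u`. Subtracting a
    -- multiple of it preserves the lead `k` and makes the vector orthogonal to `u`.
    refine extends_of_lead hw hiso hwW (x := x - beta (uvec ℓ) x • vec false s)
      (W.sub_mem hx (W.smul_mem _ (htw ▸ hwW s hs))) (k := k) ?_ (fun j hj => ?_)
      hkp.ne' hkm.ne' ?_ hkw
    · simpa [hv0 k hsk'] using hk
    · simp [hk0 j hj, hv0 j (hsk'.trans hj)]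
    · have h1 : s.1.rev ≠ pl ℓ := fun h => (hused s hs).2 (rev_eq_pl.1 h)
      have h2 : s.1.rev ≠ ml ℓ := fun h => (hused s hs).1 (rev_eq_ml.1 h)
      have : beta (uvec ℓ) (vec false s) = 1 := by
        rw [beta_vec, if_pos hs2, show (tp ℓ false).rev = pl ℓ from rev_ml]
        simp [uvec, sg_apply, h1, h2, pl_ne_ml]
      rw [beta_sub_right, beta_smul_right, this, mul_one, sub_self]
  · have h0 : ∀ j, ml ℓ < j → x j = 0 := fun j hj => hk0 j (hkm.trans_lt hj)
    -- With no coordinates past the middle, `β(x, x)` is twice this product.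
    have hpm : x (pl ℓ) * x (ml ℓ) = 0 := by
      have h := hiso x hx x hx
      rw [beta, Finset.sum_eq_add (pl ℓ) (ml ℓ) pl_ne_ml, rev_pl, rev_ml] at h
      · linear_combination h / 2
      · rintro i - ⟨h1, h2⟩
        rcases lt_or_ge (ml ℓ) i with h | h
        · rw [h0 i h, zero_mul]
        · rcases le_ml_iff.1 h with h | h | h
          · rw [h0 i.rev (ml_lt_rev.2 h), mul_zero]
          · exact absurd h h1
          · exact absurd h h2
      · simp
      · simp
    by_cases hp : x (pl ℓ) = 0
    · by_cases hm : x (ml ℓ) = 0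
      · exact hzero hp hm
      · exact extends_of_ml hw hiso hwW hused (W.smul_mem (x (ml ℓ))⁻¹ hx) (by simp [hp])
          (by simp [hm]) (fun j hj => by simp [h0 j hj])
    · have hm : x (ml ℓ) = 0 := (mul_eq_zero.1 hpm).resolve_left hp
      exact extends_of_pl hw hiso hwW hused (W.smul_mem (x (pl ℓ))⁻¹ hx) (by simp [hp])
          (by simp [hm]) (fun j hj => by simp [h0 j hj])

end Step

/-- Every flag is, up to the action of `B_{2ℓ-1}`, given by a word on its first subspaces. -/
theorem exists_word_prefix (F : IsoFlag ℓ) (m : ℕ) (hm : m ≤ ℓ - 1) :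
    ∃ g ∈ B ℓ, ∃ w : List (Sym ℓ), w.length = m ∧ Good w ∧
      ∀ i : Fin (ℓ - 1), (i : ℕ) < m → (g • F).V i = wspan (tl w) (w.take (i + 1)) := by
  induction m with
  | zero => exact ⟨1, (B ℓ).one_mem, [], rfl, ⟨by simp, by simp⟩, by simp⟩
  | succ m ih =>
    obtain ⟨g, hg, w, hwl, hw, hF⟩ := ih (by omega)
    set m' : Fin (ℓ - 1) := ⟨m, by omega⟩ with hm'
    set W := (g • F).V m' with hW
    have hfr : Module.finrank ℂ W = m + 1 := (g • F).finrank_eq m'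
    have hwW : ∀ s ∈ w, vec (tl w) s ∈ W := by
      intro s hs
      have hm0 : 0 < m := by rw [← hwl]; exact List.length_pos_of_mem hs
      have h := hF ⟨m - 1, by omega⟩ (by show m - 1 < m; omega)
      rw [List.take_of_length_le (by simp only []; omega)] at h
      exact (g • F).mono (show (⟨m - 1, by omega⟩ : Fin (ℓ - 1)) ≤ m' by simp [hm'])
        (h ▸ vec_mem_wspan hs)
    obtain ⟨h, hh, s, hws, hc, hs⟩ := exists_extends hw ((g • F).isotropic m') hwW (fun hle => by
      have := Submodule.finrank_mono hle
      rw [hfr, hw.finrank_wspan, hwl] at this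
      omega)
    set t' := tl (w ++ [s]) with ht'
    have hinv : ∀ x y, (SO.mat h).mulVec x = y → (SO.mat h⁻¹).mulVec y = x := by
      rintro x _ rfl
      rw [Matrix.mulVec_mulVec, SO.mat_inv_mul, Matrix.one_mulVec]
    -- The kind of the marked vectors may change from `tl w` to `t'`, so every prefix has to be
    -- rechecked; the scalars `c` do not affect spans.
    have hpre : ∀ w' ⊆ w, wspan t' w' ≤ (wspan (tl w) w').map (SO.mat h⁻¹).mulVecLin := by
      intro w' hw'
      refine Submodule.span_le.2 ?_
      rintro _ ⟨s', hs', rfl⟩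
      obtain ⟨c, hc0, hcs⟩ := hc s' (hw' hs')
      refine ⟨c • vec (tl w) s', Submodule.smul_mem _ _ (vec_mem_wspan hs'), ?_⟩
      exact hinv _ _ hcs
    refine ⟨h⁻¹ * g, (B ℓ).mul_mem ((B ℓ).inv_mem hh) hg, w ++ [s], by simp [hwl], hws,
      fun i hi => ?_⟩
    have hsub : ((w ++ [s]).take (i + 1)).Sublist (w ++ [s]) := List.take_sublist _ _
    have hgood : Good ((w ++ [s]).take (i + 1)) :=
      ⟨fun a ha => hws.marked a (hsub.subset ha), hws.pair.sublist hsub⟩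
    rw [mul_smul]
    -- Since `V i` has dimension `i + 1`, the number of letters in the prefix, one inclusion
    -- suffices.
    refine (Submodule.eq_of_le_of_finrank_eq ?_ ?_).symm
    · rcases (Nat.lt_succ_iff.1 hi).lt_or_eq with hi | hi
      · rw [List.take_append_of_le_length (by omega), smul_V, hF i hi]
        exact hpre _ (List.take_subset _ _)
      · have him : i = m' := Fin.ext hi
        rw [List.take_of_length_le (by simp [hi, hwl]), him]
        refine Submodule.span_le.2 ?_
        rintro _ ⟨s', hs', rfl⟩
        rcases List.mem_append.1 hs' with h' | h'
        · obtain ⟨c, hc0, hcs⟩ := hc s' h'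
          rw [← hinv _ _ hcs]
          exact smul_mem_smul_V (W.smul_mem _ (hwW s' h'))
        · rw [List.mem_singleton.1 h', ← hinv (vec t' s) _ rfl]
          exact smul_mem_smul_V hs
    · rw [hgood.finrank_wspan, (h⁻¹ • g • F).finrank_eq i]
      simp [hwl]; omega

/-- The flag `F` is encoded by the word `w`. -/
def IsWord (F : IsoFlag ℓ) (w : Fin (ℓ - 1) → Sym ℓ) : Prop :=
  Good (List.ofFn w) ∧ F.SpannedBy fun i => vec (tl (List.ofFn w)) (w i)

theorem exists_smul_isWord (F : IsoFlag ℓ) : ∃ g ∈ B ℓ, ∃ w, IsWord (g • F) w := by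
  obtain ⟨g, hg, w, hwl, hw, hF⟩ := exists_word_prefix F (ℓ - 1) le_rfl
  have hof : List.ofFn (fun i : Fin (ℓ - 1) => w.get (i.cast hwl.symm)) = w := by
    apply List.ext_getElem <;> simp [hwl]
  refine ⟨g, hg, fun i => w.get (i.cast hwl.symm), ?_⟩
  rw [IsWord, hof]
  refine ⟨hw, fun m => ?_⟩
  rw [hF m m.2, wspan]
  congr 1
  ext v
  constructor
  · rintro ⟨s, hs, rfl⟩
    obtain ⟨i, hi, rfl⟩ := List.mem_take_iff_getElem.1 hs
    exact ⟨⟨i, by omega⟩, by show i ≤ m; omega, rfl⟩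
  · rintro ⟨i, hi, rfl⟩
    have hi' : (i : ℕ) ≤ m := hi
    exact ⟨_, List.mem_take_iff_getElem.2 ⟨i, by rw [hwl]; omega, rfl⟩, rfl⟩

end

/-! ### The word as an orbit invariant, and the flag of a good word. -/

section
variable {ℓ : ℕ}

theorem mem_B_mulVec_eq_zero {g : SO (2 * ℓ)} (hg : g ∈ B ℓ) {P : Fin (2 * ℓ) → Prop}
    (hP : ∀ i j, i ≤ j → P i → P j) {x : Fin (2 * ℓ) → ℂ} (hx : ∀ j, P j → x j = 0)
    (j : Fin (2 * ℓ)) (hj : P j) : (SO.mat g).mulVec x j = 0 := by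
  show ∑ i, SO.mat g j i * x i = 0
  refine Finset.sum_eq_zero fun i _ => ?_
  rcases lt_or_ge i j with h | h
  · rw [hg.2 j i h, zero_mul]
  · rw [hx i (hP j i h hj), mul_zero]

/-- Both `g` and its inverse are upper triangular, so the lead can move neither up nor down. -/
theorem mem_B_mulVec_lead {g : SO (2 * ℓ)} (hg : g ∈ B ℓ) {k : Fin (2 * ℓ)}
    {x : Fin (2 * ℓ) → ℂ} (hk : x k ≠ 0) (hx : ∀ j, k < j → x j = 0) :
    (SO.mat g).mulVec x k ≠ 0 ∧ ∀ j, k < j → (SO.mat g).mulVec x j = 0 := by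
  have h0 := mem_B_mulVec_eq_zero hg (P := (k < ·)) (fun i j hij h => h.trans_le hij) hx
  refine ⟨fun h => hk ?_, h0⟩
  have h1 := mem_B_mulVec_eq_zero ((B ℓ).inv_mem hg) (P := (k ≤ ·))
    (fun i j hij h => h.trans hij) (x := (SO.mat g).mulVec x)
    (fun j hj => hj.eq_or_lt.elim (fun h' => h' ▸ h) (h0 j)) k le_rfl
  rwa [Matrix.mulVec_mulVec, SO.mat_inv_mul, Matrix.one_mulVec] at h1

variable [NeZero ℓ]

namespace IsWord
variable {F : IsoFlag ℓ} {w : Fin (ℓ - 1) → Sym ℓ}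

theorem good (h : IsWord F w) : Good (List.ofFn w) := h.1

theorem marked (h : IsWord F w) (i : Fin (ℓ - 1)) : (w i).2 = true → ml ℓ < (w i).1 :=
  h.1.marked _ (List.mem_ofFn.2 ⟨i, rfl⟩)

theorem ok (h : IsWord F w) {i j : Fin (ℓ - 1)} (hij : i < j) : Ok (w i) (w j) :=
  List.pairwise_ofFn.1 h.1.pair hij

theorem lead_injective (h : IsWord F w) : Function.Injective fun i => (w i).1 := by
  intro i j hij
  rcases lt_trichotomy i j with h' | h' | h'
  exacts [absurd hij (h.ok h').1, h', absurd hij.symm (h.ok h').1]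

theorem vec_mem (h : IsWord F w) {i m : Fin (ℓ - 1)} (him : i ≤ m) :
    vec (tl (List.ofFn w)) (w i) ∈ F.V m := by
  rw [h.2 m]; exact Submodule.subset_span ⟨i, him, rfl⟩

theorem exists_coeff (h : IsWord F w) {m : Fin (ℓ - 1)} {x : Fin (2 * ℓ) → ℂ} (hx : x ∈ F.V m) :
    ∃ c : Fin (ℓ - 1) → ℂ, (∀ i, c i ≠ 0 → i ≤ m) ∧
      ∑ i, c i • vec (tl (List.ofFn w)) (w i) = x := by
  rw [h.2 m, Finsupp.mem_span_image_iff_linearCombination] at hx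
  obtain ⟨c, hc, rfl⟩ := hx
  refine ⟨c, fun i hi => ?_, ?_⟩
  · exact hc (Finsupp.mem_support_iff.2 hi)
  · rw [Finsupp.linearCombination_apply]
    symm
    apply Finsupp.sum_fintype
    exact fun i => zero_smul ℂ _

/-- Because the leads are distinct, the highest one in a linear combination cannot cancel. -/
theorem exists_lead_eq (h : IsWord F w) {m : Fin (ℓ - 1)} {x : Fin (2 * ℓ) → ℂ} (hx : x ∈ F.V m)
    {k : Fin (2 * ℓ)} (hk : x k ≠ 0) (hk0 : ∀ j, k < j → x j = 0) : ∃ i ≤ m, (w i).1 = k := by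
  obtain ⟨c, hc, rfl⟩ := h.exists_coeff hx
  rw [Finset.sum_apply] at hk
  obtain ⟨i, -, hi⟩ := Finset.exists_ne_zero_of_sum_ne_zero hk
  rw [Pi.smul_apply, smul_eq_mul] at hi
  refine ⟨i, hc i (left_ne_zero_of_mul hi), ?_⟩
  rcases lt_trichotomy (w i).1 k with h' | h' | h'
  · exact absurd (vec_gt (h.marked i) h') (right_ne_zero_of_mul hi)
  · exact h'
  · exact absurd (coeff_eq_zero_of_lead h.lead_injective (fun i => vec_self (h.marked i))
      (fun i j hj => vec_gt (h.marked i) hj) (P := (k < ·))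
      (fun i j hij h => h.trans_le hij) hk0 i h') (left_ne_zero_of_mul hi)

variable {F' : IsoFlag ℓ} {w' : Fin (ℓ - 1) → Sym ℓ} {g : SO (2 * ℓ)}

/-- The image of the `m`-th vector has the same lead, which is thus among the first `m` leads of
`w'`, counted inclusively. By induction an earlier one would repeat a lead of `w`. -/
theorem lead_eq (h : IsWord F w) (h' : IsWord F' w') (hg : g ∈ B ℓ) (hF : g • F = F')
    (m : Fin (ℓ - 1)) : (w m).1 = (w' m).1 := by
  induction m using WellFoundedLT.induction with
  | ind m ih =>
    have h1 := mem_B_mulVec_lead hg (k := (w m).1) (x := vec (tl (List.ofFn w)) (w m))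
      (by rw [vec_self (h.marked m)]; exact one_ne_zero) (fun j hj => vec_gt (h.marked m) hj)
    have h2 := smul_mem_smul_V (g := g) (h.vec_mem (le_refl m))
    rw [hF] at h2
    obtain ⟨i, him, hi⟩ := h'.exists_lead_eq h2 h1.1 h1.2
    rcases him.lt_or_eq with hlt | rfl
    · exact absurd (h.lead_injective ((ih i hlt).trans hi)) hlt.ne
    · exact hi.symm

/-- If the letter of `w'` were unmarked, pulling back its basis vector would give an element of `F.V
m` with lead `k` orthogonal to `u`. A marked letter of `w` excludes such a vector. -/
theorem marked_of_marked (h : IsWord F w) (h' : IsWord F' w') (hg : g ∈ B ℓ) (hF : g • F = F')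
    (m : Fin (ℓ - 1)) (hm : (w m).2 = true) : (w' m).2 = true := by
  by_contra hm'
  have hk := h.lead_eq h' hg hF m
  set k := (w m).1 with hkdef
  have hkm : ml ℓ < k := h.marked m hm
  have hkp : pl ℓ < k := pl_lt_ml.trans hkm
  have hv' : vec (tl (List.ofFn w')) (w' m) = sg k := by
    rw [vec, if_neg hm', ← hk]
  have hxV' : sg k ∈ F'.V m := hv' ▸ h'.vec_mem le_rfl
  set x := (SO.mat g⁻¹).mulVec (sg k) with hx
  have hxV : x ∈ F.V m := by
    have := smul_mem_smul_V (g := g⁻¹) hxV'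
    rwa [← hF, inv_smul_smul] at this
  have hl := mem_B_mulVec_lead ((B ℓ).inv_mem hg) (k := k) (x := sg k) (by simp [sg_apply])
    (fun j hj => by rw [sg_apply, if_neg hj.ne'])
  have hux : beta (uvec ℓ) x = 0 := by
    have h1 : beta ((SO.mat g⁻¹).mulVec (uvec ℓ)) x = beta (uvec ℓ) (sg k) := g⁻¹.2 _ _
    rw [mem_B_uvec ((B ℓ).inv_mem hg)] at h1
    rw [h1, beta_uvec, sg_apply, sg_apply, if_neg hkm.ne, if_neg hkp.ne, sub_zero]
  obtain ⟨c, hc, hcx⟩ := h.exists_coeff hxV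
  set t := tl (List.ofFn w)
  have hbig := coeff_eq_zero_of_lead h.lead_injective (fun i => vec_self (h.marked i))
      (fun i j hj => vec_gt (h.marked i) hj) (P := (k < ·)) (c := c)
      (fun i j hij h => h.trans_le hij) (by rw [hcx]; exact hl.2)
  -- Letters before a marked one are not `e_{±ℓ}`, and the marked ones among them have leads above
  -- `k`, hence coefficient zero. So the middle coordinates of `x` come from the `m`-th vector
  -- alone.
  have hval : ∀ i, i ≠ m → c i * vec t (w i) (pl ℓ) = 0 ∧ c i * vec t (w i) (ml ℓ) = 0 := by
    intro i hi
    by_cases hci : c i = 0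
    · simp [hci]
    have him : i < m := lt_of_le_of_ne (hc i hci) hi
    have hok := (h.ok him).2.2 hm
    have hi2 : (w i).2 ≠ true := fun h2 => hci (hbig i (hok.2.2 h2))
    rw [vec_eq_zero hok.1.symm (fun h => absurd h hi2),
      vec_eq_zero hok.2.1.symm (fun h => absurd h hi2)]
    simp
  have hxi : ∀ j, (∀ i, i ≠ m → c i * vec t (w i) j = 0) → x j = c m * vec t (w m) j := by
    intro j hj
    rw [← hcx, Finset.sum_apply, Finset.sum_eq_single m]
    · rfl
    · exact fun i _ hi => hj i hi
    · simp
  have hxp := hxi (pl ℓ) fun i hi => (hval i hi).1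
  have hxm := hxi (ml ℓ) fun i hi => (hval i hi).2
  rw [beta_uvec, hxp, hxm, vec_apply, vec_apply, ← hkdef, if_neg hkm.ne, if_neg hkp.ne] at hux
  have hcm : c m = 0 := by
    rcases Bool.eq_false_or_eq_true t with ht | ht
    · rw [ht, show tp ℓ true = pl ℓ from rfl] at hux
      simpa [hm, pl_ne_ml.symm] using hux
    · rw [ht, show tp ℓ false = ml ℓ from rfl] at hux
      simpa [hm, pl_ne_ml] using hux
  have hxk : x k = 0 := by
    rw [← hcx, Finset.sum_apply]
    refine Finset.sum_eq_zero fun i _ => ?_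
    rw [Pi.smul_apply, smul_eq_mul]
    rcases lt_trichotomy (w i).1 k with h3 | h3 | h3
    · rw [vec_gt (h.marked i) h3, mul_zero]
    · rw [h.lead_injective (show (w i).1 = (w m).1 from h3), hcm, zero_mul]
    · rw [hbig i h3, zero_mul]
  exact hl.1 hxk

/-- Words are invariants of the orbits of `B_{2ℓ-1}`. -/
theorem eq_of_smul_eq (h : IsWord F w) (h' : IsWord F' w') (hg : g ∈ B ℓ) (hF : g • F = F') :
    w = w' := by
  have hF' : g⁻¹ • F' = F := by rw [← hF, inv_smul_smul]
  funext m
  refine Prod.ext (h.lead_eq h' hg hF m) (Bool.eq_iff_iff.2 ⟨?_, ?_⟩)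
  · exact h.marked_of_marked h' hg hF m
  · exact h'.marked_of_marked h ((B ℓ).inv_mem hg) hF' m

end IsWord

/-- The choice made by `tl` ensures this: if `e_ℓ` is a letter then `e_{-ℓ}` is not, and otherwise
`e_ℓ` is the vector to avoid. It is what makes the vectors of a word mutually orthogonal. -/
theorem Good.ne_rev_tp {w : List (Sym ℓ)} (hw : Good w) {s : Sym ℓ} (hs : s ∈ w) :
    s.1 ≠ (tp ℓ (tl w)).rev := by
  intro h
  have hm' : s.2 ≠ true := fun h' => by
    have := hw.marked s hs h'
    rw [h] at this
    rcases tp_cases (ℓ := ℓ) (tl w) with h2 | h2 <;> rw [h2] at this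
    · rw [rev_pl] at this; exact lt_irrefl _ this
    · rw [rev_ml] at this; exact absurd this pl_lt_ml.not_gt
  rcases Bool.eq_false_or_eq_true (tl w) with ht | ht
  · exact hw.ne_rev hs (tl_eq_true.1 ht) (by rw [h, ht]; rfl)
  · rw [ht, show tp ℓ false = ml ℓ from rfl, rev_ml] at h
    refine tl_eq_false.1 ht ?_
    convert hs
    exacts [h.symm, (Bool.eq_false_of_not_eq_true hm').symm]

theorem Good.beta_vec_vec {w : List (Sym ℓ)} (hw : Good w) {s s' : Sym ℓ} (hs : s ∈ w)
    (hs' : s' ∈ w) : beta (vec (tl w) s) (vec (tl w) s') = 0 := by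
  rw [beta_vec, vec_eq_zero (hw.ne_rev hs hs').symm, zero_add]
  · split_ifs with h
    · exact vec_eq_zero (hw.ne_rev_tp hs).symm fun _ => rev_ne _
    · rfl
  · intro h h2
    exact hw.ne_rev_tp hs' (by rw [← h2, Fin.rev_rev])

theorem beta_eq_zero_of_mem_span {n : ℕ} {S T : Set (Fin n → ℂ)}
    (h : ∀ x ∈ S, ∀ y ∈ T, beta x y = 0) {x y : Fin n → ℂ} (hx : x ∈ Submodule.span ℂ S)
    (hy : y ∈ Submodule.span ℂ T) : beta x y = 0 := by
  induction hx, hy using Submodule.span_induction₂ with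
  | mem_mem x y hx hy => exact h x hx y hy
  | zero_left y hy => exact beta_zero_left y
  | zero_right x hx => exact beta_zero_right x
  | add_left x y z _ _ _ h1 h2 => rw [beta_add_left, h1, h2, add_zero]
  | add_right x y z _ _ _ h1 h2 => rw [beta_add_right, h1, h2, add_zero]
  | smul_left r x y _ _ h1 => rw [beta_smul_left, h1, mul_zero]
  | smul_right r x y _ _ h1 => rw [beta_smul_right, h1, mul_zero]

/-- Every good word of length `ℓ - 1` encodes a flag. -/
theorem exists_isWord {w : Fin (ℓ - 1) → Sym ℓ} (hw : Good (List.ofFn w)) :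
    ∃ F : IsoFlag ℓ, IsWord F w := by
  set v := fun i => vec (tl (List.ofFn w)) (w i) with hv
  have hmem : ∀ i, w i ∈ List.ofFn w := fun i => List.mem_ofFn.2 ⟨i, rfl⟩
  have hok : ∀ i j, i < j → Ok (w i) (w j) := fun i j hij => List.pairwise_ofFn.1 hw.pair hij
  have hm := fun i => hw.marked (w i) (hmem i)
  have hinj : Function.Injective fun i => (w i).1 := fun i j hij => by
    rcases lt_trichotomy i j with h' | h' | h'
    exacts [absurd hij (hok i j h').1, h', absurd hij.symm (hok j i h').1]
  have hli : LinearIndependent ℂ v := linearIndependent_of_lead hinj (fun i => vec_self (hm i))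
    (fun i j hj => vec_gt (hm i) hj)
  refine ⟨⟨fun m => Submodule.span ℂ (v '' {i | i ≤ m}), fun m m' h => ?_, fun m => ?_,
    fun m x hx y hy => ?_⟩, hw, fun m => rfl⟩
  · exact Submodule.span_mono (Set.image_mono fun i hi => le_trans hi h)
  · have h := finrank_span_eq_card (hli.comp (Subtype.val : {i // i ≤ m} → _)
      Subtype.val_injective)
    rw [Set.range_comp, Subtype.range_coe_subtype] at h
    rw [h, Fintype.card_subtype]
    have : Finset.univ.filter (fun i => i ≤ m) = Finset.Iic m := by ext; simp
    rw [this, Fin.card_Iic]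
  · refine beta_eq_zero_of_mem_span ?_ hx hy
    rintro _ ⟨i, _, rfl⟩ _ ⟨j, _, rfl⟩
    exact hw.beta_vec_vec (hmem i) (hmem j)

end

/-! ### Flags in standard form are the flags of good words. -/

section
variable {ℓ : ℕ}

/-- The label in `{±1, …, ±ℓ}` of a position. -/
def label (k : Fin (2 * ℓ)) : ℤ := if (k : ℕ) < ℓ then k + 1 else k - 2 * ℓ

theorem e_label (k : Fin (2 * ℓ)) : e ℓ (label k) = sg k := by
  unfold label
  split_ifs with h
  · exact e_pos_eq (by omega) rfl
  · exact e_neg_eq (by omega) (by ring)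

theorem one_le_abs_label (k : Fin (2 * ℓ)) : 1 ≤ |label k| := by
  rw [le_abs]; unfold label; split_ifs <;> omega

theorem abs_label_le (k : Fin (2 * ℓ)) : |label k| ≤ ℓ := by
  rw [abs_le]; unfold label; split_ifs <;> omega

theorem exists_label {j : ℤ} (h1 : 1 ≤ |j|) (h2 : |j| ≤ ℓ) : ∃ k : Fin (2 * ℓ), label k = j := by
  rw [le_abs] at h1
  rw [abs_le] at h2
  by_cases h : 0 < j
  · refine ⟨⟨(j - 1).toNat, by omega⟩, ?_⟩
    simp only [label]; split_ifs <;> omega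
  · refine ⟨⟨(j + 2 * ℓ).toNat, by omega⟩, ?_⟩
    simp only [label]; split_ifs <;> omega

theorem label_injective : Function.Injective (label (ℓ := ℓ)) := by
  intro k k' h
  unfold label at h
  ext
  split_ifs at h <;> omega

theorem label_rev (k : Fin (2 * ℓ)) : label k.rev = -label k := by
  unfold label
  rw [Fin.val_rev]
  split_ifs <;> omega

/-- The `ℓ - 1` vectors span the last subspace, of dimension `ℓ - 1`, so they are independent. For
`ℓ = 1` there is no last subspace. -/
theorem IsoFlag.SpannedBy.injective {F : IsoFlag ℓ} {v : Fin (ℓ - 1) → Fin (2 * ℓ) → ℂ}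
    (h : F.SpannedBy v) : Function.Injective v := by
  refine LinearIndependent.injective (R := ℂ) ?_
  rw [linearIndependent_iff_card_eq_finrank_span, Fintype.card_fin, Set.finrank]
  rcases Nat.eq_zero_or_pos (ℓ - 1) with h0 | h0
  · have : IsEmpty (Fin (ℓ - 1)) := by rw [h0]; infer_instance
    rw [Set.range_eq_empty, Submodule.span_empty, finrank_bot, h0]
  · set m : Fin (ℓ - 1) := ⟨ℓ - 1 - 1, by omega⟩ with hm
    have h1 := F.finrank_eq m
    have h2 : {i | i ≤ m} = Set.univ := Set.eq_univ_of_forall fun i => by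
      show (i : ℕ) ≤ ℓ - 1 - 1; omega
    rw [h m, h2, Set.image_univ] at h1
    rw [h1, hm]
    simp only []
    omega

theorem IsoFlag.SpannedBy.beta_eq_zero {F : IsoFlag ℓ} {v : Fin (ℓ - 1) → Fin (2 * ℓ) → ℂ}
    (h : F.SpannedBy v) (i j : Fin (ℓ - 1)) : beta (v i) (v j) = 0 := by
  have hmem : ∀ i m, i ≤ m → v i ∈ F.V m := fun i m him => by
    rw [h m]; exact Submodule.subset_span ⟨i, him, rfl⟩
  exact F.isotropic (max i j) _ (hmem _ _ (le_max_left _ _)) _ (hmem _ _ (le_max_right _ _))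

theorem isStd_iff {v : Fin (2 * ℓ) → ℂ} : IsStd ℓ v ↔ ∃ k, v = sg k := by
  constructor
  · rintro ⟨j, h1, h2, rfl⟩
    obtain ⟨k, rfl⟩ := exists_label h1 h2
    exact ⟨k, e_label k⟩
  · rintro ⟨k, rfl⟩
    exact ⟨label k, one_le_abs_label k, abs_label_le k, (e_label k).symm⟩

variable [NeZero ℓ]

theorem label_pl : label (pl ℓ) = ℓ := by
  have := NeZero.pos ℓ
  simp only [label, pl]; split_ifs <;> omega

theorem ml_lt_iff {k : Fin (2 * ℓ)} : ml ℓ < k ↔ 1 ≤ -label k ∧ -label k < ℓ := by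
  have := NeZero.pos ℓ
  simp only [Fin.lt_def, ml, label]; split_ifs <;> omega

/-- The hat or tilde vector with lead `k` has index `-label k`, so increasing indices in condition
(c) mean decreasing positions. -/
theorem label_lt_label {k k' : Fin (2 * ℓ)} (h : ml ℓ < k) (h' : ml ℓ < k') :
    label k < label k' ↔ k < k' := by
  simp only [Fin.lt_def, ml, label] at *; split_ifs <;> omega

theorem hat_neg_label (k : Fin (2 * ℓ)) : hat ℓ (-label k) = vec false (k, true) := by
  rw [hat, neg_neg, e_label, e_neg_self]; rfl

theorem tilde_neg_label (k : Fin (2 * ℓ)) : tilde ℓ (-label k) = vec true (k, true) := by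
  rw [tilde, neg_neg, e_label, e_self]; rfl

theorem exists_neg_label {j : ℤ} (h1 : 1 ≤ j) (h2 : j < ℓ) :
    ∃ k : Fin (2 * ℓ), ml ℓ < k ∧ j = -label k := by
  obtain ⟨k, hk⟩ := exists_label (ℓ := ℓ) (j := -j) (by rw [le_abs]; omega) (by rw [abs_le]; omega)
  exact ⟨k, ml_lt_iff.2 (by omega), by omega⟩

theorem isHat_iff {j : ℤ} {v : Fin (2 * ℓ) → ℂ} :
    IsHat ℓ j v ↔ ∃ k, ml ℓ < k ∧ j = -label k ∧ v = vec false (k, true) := by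
  constructor
  · rintro ⟨h1, h2, rfl⟩
    obtain ⟨k, hk, rfl⟩ := exists_neg_label h1 h2
    exact ⟨k, hk, rfl, hat_neg_label k⟩
  · rintro ⟨k, hk, rfl, rfl⟩
    have := ml_lt_iff.1 hk
    exact ⟨this.1, this.2, (hat_neg_label k).symm⟩

theorem isTilde_iff {j : ℤ} {v : Fin (2 * ℓ) → ℂ} :
    IsTilde ℓ j v ↔ ∃ k, ml ℓ < k ∧ j = -label k ∧ v = vec true (k, true) := by
  constructor
  · rintro ⟨h1, h2, rfl⟩
    obtain ⟨k, hk, rfl⟩ := exists_neg_label h1 h2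
    exact ⟨k, hk, rfl, tilde_neg_label k⟩
  · rintro ⟨k, hk, rfl, rfl⟩
    have := ml_lt_iff.1 hk
    exact ⟨this.1, this.2, (tilde_neg_label k).symm⟩

/-- The lead is read off as the last non-zero position, and the mark and kind from the middle
coordinates. The kind means nothing for an unmarked symbol. -/
theorem vec_inj {t t' : Bool} {s s' : Sym ℓ} (hs : s.2 = true → ml ℓ < s.1)
    (hs' : s'.2 = true → ml ℓ < s'.1) (h : vec t s = vec t' s') :
    s = s' ∧ (s.2 = true → t = t') := by
  have h1 : s.1 = s'.1 := by
    rcases lt_trichotomy s.1 s'.1 with hlt | heq | hlt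
    · have := vec_self (t := t') hs'
      rw [← h, vec_gt hs hlt] at this
      exact absurd this zero_ne_one
    · exact heq
    · have := vec_self (t := t) hs
      rw [h, vec_gt hs' hlt] at this
      exact absurd this zero_ne_one
  have hne : ∀ t : Bool, s.2 = true ∨ s'.2 = true → tp ℓ t ≠ s.1 := by
    rintro t (h2 | h2) h3
    · exact absurd (h3 ▸ hs h2) (not_lt.2 (tp_le t))
    · exact absurd (h3 ▸ h1 ▸ hs' h2) (not_lt.2 (tp_le t))
  have key : ∀ t t' : Bool, tp ℓ t = tp ℓ t' → t = t' := by
    intro t t' h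
    cases t <;> cases t' <;> simp_all [tp, pl_ne_ml, pl_ne_ml.symm]
  have e1 := congrFun h (tp ℓ t)
  have e2 := congrFun h (tp ℓ t')
  rw [vec_apply, vec_apply, ← h1] at e1 e2
  rcases Bool.eq_false_or_eq_true s.2 with h2 | h2 <;>
    rcases Bool.eq_false_or_eq_true s'.2 with h3 | h3
  · refine ⟨Prod.ext h1 (h2.trans h3.symm), fun _ => key _ _ ?_⟩
    rw [if_neg (hne t (Or.inl h2))] at e1
    by_contra hc
    simp [h2, hc] at e1
  · rw [if_neg (hne t (Or.inl h2))] at e1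
    simp [h2, h3] at e1
  · rw [if_neg (hne t' (Or.inr h3))] at e2
    simp [h2, h3] at e2
  · exact ⟨Prod.ext h1 (h2.trans h3.symm), fun h => absurd (h2.symm.trans h) (by simp)⟩

theorem IsWord.isStandard {F : IsoFlag ℓ} {w : Fin (ℓ - 1) → Sym ℓ} (h : IsWord F w) :
    F.IsStandard := by
  refine ⟨_, h.2, ?_⟩
  have hstd : ∀ i k, vec (tl (List.ofFn w)) (w i) = sg k → w i = (k, false) := fun i k hk =>
    (vec_inj (t' := true) (s' := (k, false)) (h.marked i) (by simp) hk).1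
  have hstd' : ∀ i, (w i).2 = false → IsStd ℓ (vec (tl (List.ofFn w)) (w i)) := fun i hi =>
    isStd_iff.2 ⟨(w i).1, by simp [vec, hi]⟩
  have hhat : ∀ i j, IsHat ℓ j (vec (tl (List.ofFn w)) (w i)) →
      ∃ k, w i = (k, true) ∧ j = -label k ∧ ml ℓ < k := by
    intro i j hj
    obtain ⟨k, hk, rfl, hv⟩ := isHat_iff.1 hj
    exact ⟨k, (vec_inj (h.marked i) (fun _ => hk) hv).1, rfl, hk⟩
  have htilde : ∀ i j, IsTilde ℓ j (vec (tl (List.ofFn w)) (w i)) →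
      ∃ k, w i = (k, true) ∧ j = -label k ∧ ml ℓ < k ∧ tl (List.ofFn w) = true := by
    intro i j hj
    obtain ⟨k, hk, rfl, hv⟩ := isTilde_iff.1 hj
    obtain ⟨h1, h2⟩ := vec_inj (h.marked i) (fun _ => hk) hv
    exact ⟨k, h1, rfl, hk, h2 (by rw [h1])⟩
  have hc : ∀ i k, i < k → ∀ a b, w i = (a, true) → w k = (b, true) → ml ℓ < a → ml ℓ < b →
      -label a < -label b := by
    intro i k hik a b ha hb hma hmb
    have := (h.ok hik).2.2 (by rw [hb])
    rw [ha, hb] at this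
    exact neg_lt_neg ((label_lt_label hmb hma).2 (this.2.2 rfl))
  have hd : ∀ i k a, w i = (a, true) → vec (tl (List.ofFn w)) (w k) ≠ e ℓ (- -label a) := by
    intro i k a ha hk
    rw [neg_neg, e_label] at hk
    have h1 := hstd k a hk
    have h2 : i = k := h.lead_injective (by simp [ha, h1])
    rw [h2, h1] at ha
    simp at ha
  constructor
  · intro i
    rcases Bool.eq_false_or_eq_true (w i).2 with hi | hi
    · right
      have hwi : w i = ((w i).1, true) := Prod.ext rfl hi
      have hm := h.marked i hi
      rcases Bool.eq_false_or_eq_true (tl (List.ofFn w)) with ht | ht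
      · exact Or.inr ⟨_, isTilde_iff.2 ⟨(w i).1, hm, rfl, by rw [ht, ← hwi]⟩⟩
      · exact Or.inl ⟨_, isHat_iff.2 ⟨(w i).1, hm, rfl, by rw [ht, ← hwi]⟩⟩
    · exact Or.inl (hstd' i hi)
  · intro i hi k hik
    refine hstd' k (Bool.eq_false_of_not_eq_true fun hk => ?_)
    have := (h.ok hik).2.2 hk
    rw [e_self, e_neg_self] at hi
    rcases hi with hi | hi <;> rw [hstd i _ hi] at this
    exacts [this.1 rfl, this.2.1 rfl]
  · rintro ⟨i, j, hj⟩
    obtain ⟨k, -, -, -, ht⟩ := htilde i j hj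
    obtain ⟨i', hi'⟩ := List.mem_ofFn.1 (tl_eq_true.1 ht)
    exact ⟨i', by rw [hi', e_self]; rfl⟩
  · intro i k hik a b ha hb
    obtain ⟨a, ha', rfl, hma⟩ := hhat i a ha
    obtain ⟨b, hb', rfl, hmb⟩ := hhat k b hb
    exact hc i k hik a b ha' hb' hma hmb
  · intro i k hik a b ha hb
    obtain ⟨a, ha', rfl, hma, -⟩ := htilde i a ha
    obtain ⟨b, hb', rfl, hmb, -⟩ := htilde k b hb
    exact hc i k hik a b ha' hb' hma hmb
  · intro i k j hj
    obtain ⟨a, ha, rfl, -⟩ := hhat i j hj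
    exact hd i k a ha
  · intro i k j hj
    obtain ⟨a, ha, rfl, -⟩ := htilde i j hj
    exact hd i k a ha

/-- Every flag in standard form is encoded by a word. -/
theorem exists_isWord_of_isStandard {F : IsoFlag ℓ} (hF : F.IsStandard) : ∃ w, IsWord F w := by
  obtain ⟨v, hFv, hv⟩ := hF
  have hinj := hFv.injective
  have hβ := hFv.beta_eq_zero
  have hex : ∀ i, ∃ (t : Bool) (s : Sym ℓ), (s.2 = true → ml ℓ < s.1) ∧ v i = vec t s := by
    intro i
    rcases hv.form i with h | ⟨j, h⟩ | ⟨j, h⟩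
    · obtain ⟨k, hk⟩ := isStd_iff.1 h
      -- The kind `true` is arbitrary here.
      exact ⟨true, (k, false), by simp, hk⟩
    · obtain ⟨k, hk, -, h⟩ := isHat_iff.1 h
      exact ⟨false, (k, true), fun _ => hk, h⟩
    · obtain ⟨k, hk, -, h⟩ := isTilde_iff.1 h
      exact ⟨true, (k, true), fun _ => hk, h⟩
  choose t w hm hvw using hex
  have hw2 : ∀ i, (w i).2 = false → v i = sg (w i).1 := fun i hi => by
    rw [hvw, vec, hi]; rfl
  have hhat : ∀ i, (w i).2 = true → t i = false → IsHat ℓ (-label (w i).1) (v i) := fun i hi ht =>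
    isHat_iff.2 ⟨_, hm i hi, rfl, by rw [hvw, ht]; congr 1; exact Prod.ext rfl hi⟩
  have htilde : ∀ i, (w i).2 = true → t i = true → IsTilde ℓ (-label (w i).1) (v i) :=
    fun i hi ht => isTilde_iff.2 ⟨_, hm i hi, rfl, by rw [hvw, ht]; congr 1; exact Prod.ext rfl hi⟩
  have hrev : ∀ i j, (w i).2 = true → (w j).2 = true → (w i).1 ≠ (w j).1.rev := by
    intro i j hi hj h
    have h1 := rev_lt_pl.2 (hm j hj)
    rw [← h] at h1
    exact absurd (pl_lt_ml.trans (hm i hi)) h1.not_gt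
  -- hat vectors and tilde vectors do not both occur
  have htt : ∀ i j, (w i).2 = true → (w j).2 = true → t i = t j := by
    intro i j hi hj
    by_contra hij
    have h1 := hβ i j
    have h2 : (tp ℓ (t j)).rev = tp ℓ (t i) := by
      cases hti : t i <;> cases htj : t j
      · simp [hti, htj] at hij
      · exact rev_pl
      · exact rev_ml
      · simp [hti, htj] at hij
    rw [hvw i, hvw j, beta_vec, if_pos hj, h2, vec_apply, vec_apply,
      if_neg (hrev i j hi hj).symm, if_neg, if_neg, if_pos ⟨hi, rfl⟩] at h1
    · norm_num at h1
    · exact ((tp_le _).trans_lt (hm i hi)).ne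
    · rintro ⟨-, h3⟩
      have h4 := rev_lt_pl.2 (hm j hj)
      rw [h3] at h4
      rcases tp_cases (ℓ := ℓ) (t i) with h5 | h5 <;> rw [h5] at h4
      exacts [lt_irrefl _ h4, absurd h4 pl_lt_ml.not_gt]
  -- A tilde vector forces `e_ℓ` to occur by condition (b); a hat vector excludes it, since the two
  -- pair to `1`.
  have htl : ∀ i, (w i).2 = true → t i = tl (List.ofFn w) := by
    intro i hi
    rcases Bool.eq_false_or_eq_true (t i) with ht | ht
    · obtain ⟨k, hk⟩ := hv.cond_b ⟨i, _, htilde i hi ht⟩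
      rw [e_self, hvw] at hk
      have h1 := (vec_inj (t' := true) (s' := (pl ℓ, false)) (hm k) (by simp) hk).1
      rw [ht, eq_comm, tl_eq_true]
      exact List.mem_ofFn.2 ⟨k, h1⟩
    · rw [ht, eq_comm, tl_eq_false]
      intro hmem
      obtain ⟨k, hk⟩ := List.mem_ofFn.1 hmem
      have h1 := hβ i k
      rw [hvw i, hvw k, hk, vec_false, beta_sg_right, rev_pl, ht, vec_apply,
        if_neg (hm i hi).ne, if_pos ⟨hi, rfl⟩] at h1
      norm_num at h1
  have hok1 : ∀ i j, (w i).1 = (w j).1 → i = j := by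
    intro i j hij
    rcases Bool.eq_false_or_eq_true (w i).2 with hi | hi <;>
      rcases Bool.eq_false_or_eq_true (w j).2 with hj | hj
    · refine hinj ?_
      rw [hvw, hvw, htt i j hi hj]
      congr 1
      exact Prod.ext hij (hi.trans hj.symm)
    -- Equal leads with different marks are what condition (d) forbids.
    · have h1 : v j = e ℓ (- -label (w i).1) := by rw [neg_neg, e_label, hw2 j hj, hij]
      rcases Bool.eq_false_or_eq_true (t i) with ht | ht
      · exact absurd h1 (hv.cond_d_tilde i j _ (htilde i hi ht))
      · exact absurd h1 (hv.cond_d_hat i j _ (hhat i hi ht))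
    · have h1 : v i = e ℓ (- -label (w j).1) := by rw [neg_neg, e_label, hw2 i hi, hij]
      rcases Bool.eq_false_or_eq_true (t j) with ht | ht
      · exact absurd h1 (hv.cond_d_tilde j i _ (htilde j hj ht))
      · exact absurd h1 (hv.cond_d_hat j i _ (hhat j hj ht))
    · exact hinj (by rw [hw2 i hi, hw2 j hj, hij])
  have hok2' : ∀ i j, (w j).2 = false → (w i).1 ≠ (w j).1.rev := by
    intro i j hj h
    have h1 := hβ i j
    rw [hw2 j hj, beta_sg_right, ← h, hvw, vec_self (hm i)] at h1
    exact one_ne_zero h1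
  have hok2 : ∀ i j, (w i).1 ≠ (w j).1.rev := by
    intro i j
    rcases Bool.eq_false_or_eq_true (w j).2 with hj | hj
    · rcases Bool.eq_false_or_eq_true (w i).2 with hi | hi
      · exact hrev i j hi hj
      · exact fun h => hok2' j i hi (by rw [h, Fin.rev_rev])
    · exact hok2' i j hj
  have hunm : ∀ i k, (w i).1 = k → k = pl ℓ ∨ k = ml ℓ → v i = sg k := by
    rintro i k rfl hk
    refine hw2 i (Bool.eq_false_of_not_eq_true fun hi => ?_)
    have := hm i hi
    rcases hk with h | h <;> rw [h] at this
    exacts [absurd this pl_lt_ml.not_gt, lt_irrefl _ this]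
  refine ⟨w, ⟨fun s hs => ?_, List.pairwise_ofFn.2 fun i j hij => ⟨fun h => hij.ne (hok1 i j h),
    hok2 i j, fun hj => ?_⟩⟩, fun m => ?_⟩
  · obtain ⟨i, rfl⟩ := List.mem_ofFn.1 hs
    exact hm i
  · have hns : ¬ IsStd ℓ (v j) := fun h => by
      obtain ⟨k, hk⟩ := isStd_iff.1 h
      rw [hvw] at hk
      have h1 := (vec_inj (t' := true) (s' := (k, false)) (hm j) (by simp) hk).1
      rw [h1] at hj
      simp at hj
    refine ⟨fun h => hns (hv.cond_a i (Or.inl ?_) j hij), fun h => hns (hv.cond_a i (Or.inr ?_) j hij),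
      fun hi => ?_⟩
    · rw [e_self]; exact hunm i _ h (Or.inl rfl)
    · rw [e_neg_self]; exact hunm i _ h (Or.inr rfl)
    · rw [← label_lt_label (hm j hj) (hm i hi), ← neg_lt_neg_iff]
      rcases Bool.eq_false_or_eq_true (t i) with ht | ht
      · exact hv.cond_c_tilde i j hij _ _ (htilde i hi ht) (htilde j hj (htt i j hi hj ▸ ht))
      · exact hv.cond_c_hat i j hij _ _ (hhat i hi ht) (hhat j hj (htt i j hi hj ▸ ht))
  · rw [hFv m]
    congr 2
    funext i
    rw [hvw i]
    rcases Bool.eq_false_or_eq_true (w i).2 with hi | hi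
    · rw [htl i hi]
    · simp [vec, hi]

end

/-! ### Combinatorics: signed partitions and words of signed symbols. -/

section
variable {ℓ : ℕ}

section Encoding

/-- The signed symbols of a list: the last entry is marked. -/
def blockSyms (σ : List ℤ) : List (ℤ × Bool) :=
  σ.dropLast.map (·, false) ++ σ.getLast?.toList.map (·, true)

/-- The signed symbols of the lists `σ_1, …, σ_{t-1}` (forming `L`) and `σ_t = τ`. -/
def encode (L : List (List ℤ)) (τ : List ℤ) : List (ℤ × Bool) :=
  L.flatMap blockSyms ++ τ.dropLast.map (·, false)

/-- Cutting a word after its marked symbols. -/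
def decode : List (ℤ × Bool) → List (List ℤ) × List ℤ
  | [] => ([], [])
  | (j, true) :: z => ([j] :: (decode z).1, (decode z).2)
  | (j, false) :: z =>
    match decode z with
    | ([], t) => ([], j :: t)
    | (σ :: L, t) => ((j :: σ) :: L, t)

theorem decode_map_unmarked (t : List ℤ) : decode (t.map (·, false)) = ([], t) := by
  induction t with
  | nil => rfl
  | cons j t ih => simp [decode, ih]

theorem blockSyms_cons_cons (i j : ℤ) (σ : List ℤ) :
    blockSyms (i :: j :: σ) = (i, false) :: blockSyms (j :: σ) := by
  simp [blockSyms]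

theorem decode_blockSyms_append {σ : List ℤ} (hσ : σ ≠ []) (z : List (ℤ × Bool)) :
    decode (blockSyms σ ++ z) = (σ :: (decode z).1, (decode z).2) := by
  induction σ with
  | nil => exact absurd rfl hσ
  | cons i σ ih =>
    cases σ with
    | nil => simp [blockSyms, decode]
    | cons j σ =>
      rw [blockSyms_cons_cons, List.cons_append, decode, ih (by simp)]

theorem decode_encode {L : List (List ℤ)} (hL : ∀ σ ∈ L, σ ≠ []) (τ : List ℤ) :
    decode (encode L τ) = (L, τ.dropLast) := by
  induction L with
  | nil => exact decode_map_unmarked _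
  | cons σ L ih =>
    have ih := ih fun σ' h => hL σ' (List.mem_cons_of_mem _ h)
    rw [encode] at ih ⊢
    rw [List.flatMap_cons, List.append_assoc, decode_blockSyms_append (hL σ (by simp)), ih]

/-- The last entry of `σ_t` does not enter the word, so it is left free as `a` and fixed later by
counting. -/
theorem exists_encode (z : List (ℤ × Bool)) :
    ∃ (L : List (List ℤ)) (t : List ℤ), (∀ σ ∈ L, σ ≠ []) ∧ ∀ a, encode L (t ++ [a]) = z := by
  induction z with
  | nil => exact ⟨[], [], by simp, by simp [encode]⟩
  | cons s z ih =>
    obtain ⟨L, t, hL, hz⟩ := ih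
    rcases s with ⟨j, _ | _⟩
    · cases L with
      | nil => exact ⟨[], j :: t, by simp, fun a => by
          rw [← hz a, encode, encode, ← List.cons_append, List.dropLast_concat, List.dropLast_concat]
          rfl⟩
      | cons σ L =>
        obtain ⟨i, σ, rfl⟩ := List.exists_cons_of_ne_nil (hL σ (by simp))
        refine ⟨(j :: i :: σ) :: L, t, ?_, fun a => ?_⟩
        · intro σ' h
          rcases List.mem_cons.1 h with rfl | h
          · simp
          · exact hL σ' (by simp [h])
        · rw [← hz a, encode, encode, List.flatMap_cons, List.flatMap_cons, blockSyms_cons_cons]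
          rfl
    · refine ⟨[j] :: L, t, ?_, fun a => by rw [← hz a]; simp [encode, blockSyms]⟩
      intro σ' h
      rcases List.mem_cons.1 h with rfl | h
      · simp
      · exact hL σ' h

theorem map_fst_blockSyms (σ : List ℤ) : (blockSyms σ).map Prod.fst = σ := by
  rcases List.eq_nil_or_concat σ with rfl | ⟨σ, a, rfl⟩ <;> simp [blockSyms, Function.comp_def]

theorem map_fst_encode (L : List (List ℤ)) (τ : List ℤ) :
    (encode L τ).map Prod.fst = L.flatten ++ τ.dropLast := by
  simp [encode, List.map_flatMap, map_fst_blockSyms, Function.comp_def]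

theorem mem_encode_true {L : List (List ℤ)} {τ : List ℤ} {a : ℤ} :
    (a, true) ∈ encode L τ ↔ ∃ σ ∈ L, σ.getLast? = some a := by
  simp [encode, blockSyms, -List.map_dropLast]

theorem mem_encode_false {L : List (List ℤ)} {τ : List ℤ} {a : ℤ} :
    (a, false) ∈ encode L τ ↔ (∃ σ ∈ L, a ∈ σ.dropLast) ∨ a ∈ τ.dropLast := by
  simp [encode, blockSyms, -List.map_dropLast]

end Encoding

/-- The conditions on the lists in a signed partition into lists of `{1, …, ℓ}`. -/
structure IsPartition (ℓ : ℕ) (M : List (List ℤ)) : Prop where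
  nonempty : ∀ σ ∈ M, σ ≠ []
  nodup : (M.flatten.map Int.natAbs).Nodup
  mem_iff : ∀ a, a ∈ M.flatten.map Int.natAbs ↔ a ∈ Finset.Icc 1 ℓ
  last_nonneg : ∀ σ ∈ M, ∀ x, σ.getLast? = some x → 0 ≤ x

/-- `L` and `τ` list the elements of `S` in the order used in the definition of `Γ`. -/
structure IsListing (ℓ : ℕ) (S : Finset (List ℤ)) (L : List (List ℤ)) (τ : List ℤ) : Prop where
  nodup : (L ++ [τ]).Nodup
  mem_iff : ∀ σ, σ ∈ L ++ [τ] ↔ σ ∈ S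
  mem_last : (ℓ : ℤ) ∈ τ ∨ (-ℓ : ℤ) ∈ τ
  sorted : L.Pairwise fun σ σ' => ∀ a b, σ.getLast? = some a → σ'.getLast? = some b → a < b

theorem IsSPIL.isPartition {S : Finset (List ℤ)} (hS : IsSPIL (Finset.Icc 1 ℓ) S)
    {M : List (List ℤ)} (hM : M.Nodup) (h : ∀ σ, σ ∈ M ↔ σ ∈ S) : IsPartition ℓ M where
  nonempty σ hσ := hS.nonempty σ ((h σ).1 hσ)
  last_nonneg σ hσ := hS.last_nonneg σ ((h σ).1 hσ)
  nodup := by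
    rw [List.map_flatten, List.nodup_flatten]
    constructor
    · intro l hl
      obtain ⟨σ, hσ, rfl⟩ := List.mem_map.1 hl
      exact hS.nodup σ ((h σ).1 hσ)
    · rw [List.pairwise_map]
      refine List.Pairwise.imp_of_mem (fun {σ σ'} hσ hσ' hne a ha ha' => hne ?_) hM
      obtain ⟨x, hx, rfl⟩ := List.mem_map.1 ha
      have hA := hS.mem σ ((h σ).1 hσ) x hx
      exact (hS.partition _ hA).unique ⟨(h σ).1 hσ, ha⟩ ⟨(h σ').1 hσ', ha'⟩
  mem_iff a := by
    constructor
    · intro ha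
      obtain ⟨x, hx, rfl⟩ := List.mem_map.1 ha
      obtain ⟨σ, hσ, hx⟩ := List.mem_flatten.1 hx
      exact hS.mem σ ((h σ).1 hσ) x hx
    · intro ha
      obtain ⟨σ, ⟨hσ, haσ⟩, -⟩ := hS.partition a ha
      obtain ⟨x, hx, rfl⟩ := List.mem_map.1 haσ
      exact List.mem_map_of_mem (List.mem_flatten.2 ⟨σ, (h σ).2 hσ, hx⟩)

namespace IsPartition
variable {M : List (List ℤ)}

theorem pairwise_disjoint (h : IsPartition ℓ M) :
    M.Pairwise fun σ σ' => List.Disjoint (σ.map Int.natAbs) (σ'.map Int.natAbs) := by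
  have := h.nodup
  rw [List.map_flatten, List.nodup_flatten, List.pairwise_map] at this
  exact this.2

theorem nodup_of_mem (h : IsPartition ℓ M) {σ : List ℤ} (hσ : σ ∈ M) :
    (σ.map Int.natAbs).Nodup := by
  have := h.nodup
  rw [List.map_flatten, List.nodup_flatten] at this
  exact this.1 _ (List.mem_map_of_mem hσ)

theorem eq_of_mem (h : IsPartition ℓ M) {σ σ' : List ℤ} (hσ : σ ∈ M) (hσ' : σ' ∈ M) {a : ℕ}
    (ha : a ∈ σ.map Int.natAbs) (ha' : a ∈ σ'.map Int.natAbs) : σ = σ' := by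
  by_contra hne
  have : Std.Symm fun σ σ' : List ℤ =>
      List.Disjoint (σ.map Int.natAbs) (σ'.map Int.natAbs) := ⟨fun _ _ h => h.symm⟩
  exact h.pairwise_disjoint.forall hσ hσ' hne ha ha'

theorem mem_Icc (h : IsPartition ℓ M) {σ : List ℤ} (hσ : σ ∈ M) {x : ℤ} (hx : x ∈ σ) :
    1 ≤ x.natAbs ∧ x.natAbs ≤ ℓ :=
  Finset.mem_Icc.1 ((h.mem_iff _).1 (List.mem_map_of_mem (List.mem_flatten.2 ⟨σ, hσ, hx⟩)))

theorem list_nodup (h : IsPartition ℓ M) : M.Nodup := by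
  refine h.pairwise_disjoint.imp_of_mem fun {σ σ'} hσ hσ' hd heq => ?_
  obtain ⟨i, σ, rfl⟩ := List.exists_cons_of_ne_nil (h.nonempty σ hσ)
  subst heq
  exact hd (a := i.natAbs) (by simp) (by simp)

theorem isSPIL (h : IsPartition ℓ M) : IsSPIL (Finset.Icc 1 ℓ) M.toFinset where
  nonempty σ hσ := h.nonempty σ (List.mem_toFinset.1 hσ)
  mem σ hσ x hx := Finset.mem_Icc.2 (h.mem_Icc (List.mem_toFinset.1 hσ) hx)
  nodup σ hσ := h.nodup_of_mem (List.mem_toFinset.1 hσ)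
  partition a ha := by
    obtain ⟨x, hx, rfl⟩ := List.mem_map.1 ((h.mem_iff a).2 ha)
    obtain ⟨σ, hσ, hx⟩ := List.mem_flatten.1 hx
    refine ⟨σ, ⟨List.mem_toFinset.2 hσ, List.mem_map_of_mem hx⟩, fun σ' hσ' => ?_⟩
    exact h.eq_of_mem (List.mem_toFinset.1 hσ'.1) hσ hσ'.2 (List.mem_map_of_mem hx)
  last_nonneg σ hσ := h.last_nonneg σ (List.mem_toFinset.1 hσ)
  zero_last σ hσ h0 := by
    have := h.mem_Icc (List.mem_toFinset.1 hσ) h0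
    simp at this

theorem length_flatten (h : IsPartition ℓ M) : M.flatten.length = ℓ := by
  have h1 : (M.flatten.map Int.natAbs).toFinset = Finset.Icc 1 ℓ := by
    ext a; rw [List.mem_toFinset, h.mem_iff]
  have h2 := List.toFinset_card_of_nodup h.nodup
  rw [h1, Nat.card_Icc, List.length_map] at h2
  omega

end IsPartition

theorem IsListing.isPartition {S : Finset (List ℤ)} {L : List (List ℤ)} {τ : List ℤ}
    (h : IsListing ℓ S L τ) (hS : IsSPIL (Finset.Icc 1 ℓ) S) : IsPartition ℓ (L ++ [τ]) :=
  hS.isPartition h.nodup h.mem_iff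

theorem natAbs_mem_map {σ : List ℤ} {a : ℕ} :
    a ∈ σ.map Int.natAbs ↔ (a : ℤ) ∈ σ ∨ (-a : ℤ) ∈ σ := by
  rw [List.mem_map]
  constructor
  · rintro ⟨x, hx, rfl⟩
    rcases Int.natAbs_eq x with h | h
    · exact Or.inl (h ▸ hx)
    · exact Or.inr (h ▸ hx)
  · rintro (h | h)
    · exact ⟨_, h, by simp⟩
    · exact ⟨_, h, by simp⟩

/-- The lists of a signed partition can be ordered as in the definition of `Γ`. -/
theorem exists_isListing (hℓ : 1 ≤ ℓ) {S : Finset (List ℤ)} (hS : IsSPIL (Finset.Icc 1 ℓ) S) :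
    ∃ L τ, IsListing ℓ S L τ := by
  classical
  obtain ⟨τ, ⟨hτ, hlτ⟩, -⟩ := hS.partition ℓ (Finset.mem_Icc.2 ⟨hℓ, le_rfl⟩)
  -- The default `0` is harmless, as the lists of `S` are non-empty.
  let r : List ℤ → List ℤ → Prop := fun σ σ' => σ.getLast?.getD 0 ≤ σ'.getLast?.getD 0
  have : Std.Total r := ⟨fun _ _ => le_total _ _⟩
  have : IsTrans (List ℤ) r := ⟨fun _ _ _ => le_trans⟩
  set L := (S.erase τ).toList.insertionSort r with hL
  have hmem : ∀ σ, σ ∈ L ↔ σ ≠ τ ∧ σ ∈ S := fun σ => by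
    rw [hL, List.mem_insertionSort, Finset.mem_toList, Finset.mem_erase]
  have hLn : L.Nodup := (List.perm_insertionSort r _).nodup_iff.2 (Finset.nodup_toList _)
  refine ⟨L, τ, ?_, fun σ => ?_, natAbs_mem_map.1 hlτ, ?_⟩
  · rw [List.nodup_append]
    refine ⟨hLn, by simp, fun σ hσ σ' hσ' => ?_⟩
    rw [List.mem_singleton.1 hσ']
    exact ((hmem σ).1 hσ).1
  · rw [List.mem_append, hmem, List.mem_singleton]
    constructor
    · rintro (h | rfl)
      exacts [h.2, hτ]
    · intro h
      by_cases h' : σ = τ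
      exacts [Or.inr h', Or.inl ⟨h', h⟩]
  · refine List.Pairwise.imp_of_mem (fun {σ σ'} hσ hσ' h a b ha hb => ?_)
      ((List.pairwise_insertionSort r (S.erase τ).toList).and hLn)
    have h1 := h.1
    simp only [r, ha, hb, Option.getD_some] at h1
    -- The sorting is strict because distinct lists of a partition share no entry.
    refine lt_of_le_of_ne h1 fun hab => h.2 ?_
    subst hab
    have haσ := List.mem_of_getLast? ha
    have h2 := hS.mem σ ((hmem σ).1 hσ).2 a haσ
    exact (hS.partition _ h2).unique ⟨((hmem σ).1 hσ).2, List.mem_map_of_mem haσ⟩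
      ⟨((hmem σ').1 hσ').2, List.mem_map_of_mem (List.mem_of_getLast? hb)⟩

/-- The order of the lists of a signed partition is unique. -/
theorem IsListing.unique (hℓ : 1 ≤ ℓ) {S : Finset (List ℤ)} (hS : IsSPIL (Finset.Icc 1 ℓ) S)
    {L L' : List (List ℤ)} {τ τ' : List ℤ} (h : IsListing ℓ S L τ) (h' : IsListing ℓ S L' τ') :
    L = L' ∧ τ = τ' := by
  have hτ : τ = τ' := (hS.partition ℓ (Finset.mem_Icc.2 ⟨hℓ, le_rfl⟩)).unique
    ⟨(h.mem_iff τ).1 (by simp), natAbs_mem_map.2 h.mem_last⟩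
    ⟨(h'.mem_iff τ').1 (by simp), natAbs_mem_map.2 h'.mem_last⟩
  subst hτ
  refine ⟨?_, rfl⟩
  have h1 := List.nodup_append.1 h.nodup
  have h1' := List.nodup_append.1 h'.nodup
  have hperm : L.Perm L' := by
    refine (List.perm_ext_iff_of_nodup h1.1 h1'.1).2 fun σ => ?_
    have h2 := (h.mem_iff σ).trans (h'.mem_iff σ).symm
    rw [List.mem_append, List.mem_append, List.mem_singleton] at h2
    constructor
    · intro hσ
      exact (h2.1 (Or.inl hσ)).resolve_right (h1.2.2 σ hσ τ (by simp))
    · intro hσ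
      exact (h2.2 (Or.inl hσ)).resolve_right (h1'.2.2 σ hσ τ (by simp))
  refine hperm.eq_of_pairwise (fun σ σ' hσ hσ' hlt hgt => ?_) h.sorted h'.sorted
  have hne := hS.nonempty σ ((h.mem_iff σ).1 (by simp [hσ]))
  have hne' := hS.nonempty σ' ((h'.mem_iff σ').1 (by simp [hσ']))
  exact absurd (hlt _ _ (List.getLast?_eq_some_getLast hne) (List.getLast?_eq_some_getLast hne'))
    (hgt _ _ (List.getLast?_eq_some_getLast hne') (List.getLast?_eq_some_getLast hne)).not_gt

/-- The relation between two signed symbols in the word of a flag in standard form. -/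
def ZOk (ℓ : ℕ) (s s' : ℤ × Bool) : Prop :=
  s.1.natAbs ≠ s'.1.natAbs ∧ (s'.2 = true → s.1.natAbs ≠ ℓ ∧ (s.2 = true → s.1 < s'.1))

/-- The words of signed symbols that encode flags in standard form. -/
structure ZGood (ℓ : ℕ) (z : List (ℤ × Bool)) : Prop where
  range : ∀ s ∈ z, 1 ≤ s.1.natAbs ∧ s.1.natAbs ≤ ℓ ∧ (s.2 = true → 0 < s.1 ∧ s.1 < ℓ)
  pair : z.Pairwise (ZOk ℓ)

section Listing
variable {L : List (List ℤ)} {τ : List ℤ}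

theorem natAbs_ne_of_mem (h : IsPartition ℓ (L ++ [τ])) (hτ : (ℓ : ℤ) ∈ τ ∨ (-ℓ : ℤ) ∈ τ)
    {σ : List ℤ} (hσ : σ ∈ L) {x : ℤ} (hx : x ∈ σ) : x.natAbs ≠ ℓ := by
  intro hxl
  have h1 := (List.pairwise_append.1 h.pairwise_disjoint).2.2 σ hσ τ (by simp)
  refine h1 (List.mem_map_of_mem hx) ?_
  rw [hxl]
  exact natAbs_mem_map.2 hτ

/-- All marked symbols come from `L`, where `±ℓ` does not occur, and `τ` contributes only unmarked
ones at the end. The order of marked symbols is the order of last entries. -/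
theorem zGood_encode (h : IsPartition ℓ (L ++ [τ])) (hτ : (ℓ : ℤ) ∈ τ ∨ (-ℓ : ℤ) ∈ τ)
    (hL : L.Pairwise fun σ σ' => ∀ a b, σ.getLast? = some a → σ'.getLast? = some b → a < b) :
    ZGood ℓ (encode L τ) := by
  have hmemL : ∀ σ ∈ L, ∀ s ∈ blockSyms σ, s.1 ∈ σ := fun σ _ s hs => by
    have := List.mem_map_of_mem (f := Prod.fst) hs
    rwa [map_fst_blockSyms] at this
  have hsub : ((encode L τ).map Prod.fst).Sublist (L ++ [τ]).flatten := by
    rw [map_fst_encode, List.flatten_append]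
    simpa using (List.dropLast_sublist τ)
  have hlast : ∀ σ, ∀ s ∈ blockSyms σ, s.2 = true → σ.getLast? = some s.1 := by
    rintro σ ⟨a, b⟩ hs rfl
    simpa [blockSyms, -List.map_dropLast] using hs
  constructor
  · intro s hs
    have h1 := hsub.subset (List.mem_map_of_mem (f := Prod.fst) hs)
    obtain ⟨σ, hσ, hsσ⟩ := List.mem_flatten.1 h1
    have h2 := h.mem_Icc hσ hsσ
    refine ⟨h2.1, h2.2, fun hs2 => ?_⟩
    rcases s with ⟨a, b⟩
    obtain rfl : b = true := hs2
    obtain ⟨σ', hσ', ha⟩ := mem_encode_true.1 hs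
    have h3 := h.last_nonneg σ' (by simp [hσ']) a ha
    have h4 := natAbs_ne_of_mem h hτ hσ' (List.mem_of_getLast? ha)
    simp only at h2
    constructor <;> simp only [] <;> omega
  · refine List.Pairwise.and ?_ ?_
    · have := (hsub.map Int.natAbs).nodup h.nodup
      rw [List.Nodup, List.pairwise_map, List.pairwise_map] at this
      exact this
    · rw [encode, List.pairwise_append, List.pairwise_flatMap]
      have hun : ∀ (t : List ℤ), ∀ s ∈ t.map (·, false), s.2 = false := by
        intro t s hs
        obtain ⟨a, -, rfl⟩ := List.mem_map.1 hs
        rfl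
      refine ⟨⟨fun σ hσ => ?_, ?_⟩, ?_, fun s hs s' hs' h2 => ?_⟩
      · rw [blockSyms, List.pairwise_append]
        refine ⟨?_, ?_, fun s hs s' hs' _ => ⟨?_, fun h2 => ?_⟩⟩
        · exact List.pairwise_of_forall_mem_list fun s _ s' hs' h2 => by
            simp [hun _ s' hs'] at h2
        · cases σ.getLast? <;> simp
        · exact natAbs_ne_of_mem h hτ hσ
            (hmemL σ hσ s (by rw [blockSyms]; exact List.mem_append_left _ hs))
        · simp [hun _ s hs] at h2
      · refine hL.imp_of_mem fun {σ σ'} hσ hσ' hlt s hs s' hs' hs2' => ⟨?_, fun hs2 => ?_⟩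
        · exact natAbs_ne_of_mem h hτ hσ (hmemL σ hσ s hs)
        · exact hlt _ _ (hlast σ s hs hs2) (hlast σ' s' hs' hs2')
      · exact List.pairwise_of_forall_mem_list fun s _ s' hs' h2 => by
          simp [hun _ s' hs'] at h2
      · simp [hun _ s' hs'] at h2

theorem length_encode (h : IsPartition ℓ (L ++ [τ])) : (encode L τ).length = ℓ - 1 := by
  have h1 := h.length_flatten
  have h2 := congrArg List.length (map_fst_encode L τ)
  have h3 := h.nonempty τ (by simp)
  have h4 := List.length_pos_iff.2 h3
  simp only [List.length_map, List.length_append, List.length_dropLast, List.flatten_append,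
    List.flatten_cons, List.flatten_nil, List.append_nil] at h1 h2
  omega

/-- The kind of the marked vectors is determined by whether `ℓ` occurs in the word. -/
theorem mem_encode_iff (h : IsPartition ℓ (L ++ [τ])) (hτ : (ℓ : ℤ) ∈ τ ∨ (-ℓ : ℤ) ∈ τ) :
    ((ℓ : ℤ), false) ∈ encode L τ ↔ ¬ (τ.getLast? = some (ℓ : ℤ) ∨ (-ℓ : ℤ) ∈ τ) := by
  have hne := h.nonempty τ (by simp)
  have hnd := h.nodup_of_mem (σ := τ) (by simp)
  have hpos : 1 ≤ ℓ := by
    rcases hτ with h' | h' <;> have := h.mem_Icc (σ := τ) (by simp) h' <;> omega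
  have hnn := h.last_nonneg τ (by simp)
  obtain ⟨t, a, rfl⟩ := (List.eq_nil_or_concat τ).resolve_left hne
  rw [mem_encode_false]
  have h1 : ¬ ∃ σ ∈ L, (ℓ : ℤ) ∈ σ.dropLast := by
    rintro ⟨σ, hσ, hl⟩
    exact natAbs_ne_of_mem h hτ hσ (List.dropLast_subset _ hl) (by simp)
  simp only [List.concat_eq_append, List.dropLast_concat, List.getLast?_concat,
    Option.some.injEq, List.mem_append, List.mem_singleton, List.map_append, List.nodup_append,
    List.mem_map, List.map_cons, List.map_nil] at *
  have hnna := hnn a rfl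
  constructor
  · rintro (h2 | h2)
    · exact absurd h2 h1
    · have h3 := hnd.2.2 _ ⟨_, h2, rfl⟩ _ rfl
      rintro (h4 | h4 | h4)
      · exact h3 (by rw [h4])
      · have h5 : ((ℓ : ℤ)) = -ℓ := List.inj_on_of_nodup_map hnd.1 h2 h4 (by simp)
        omega
      · omega
  · intro h2
    right
    rcases hτ with (h3 | h3) | h3
    · exact h3
    · exact absurd (Or.inl h3.symm) h2
    · exact absurd (Or.inr h3) h2

end Listing

/-- Signed partitions with the same word are equal. -/
theorem eq_of_encode_eq {S S' : Finset (List ℤ)} (hS : IsSPIL (Finset.Icc 1 ℓ) S)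
    (hS' : IsSPIL (Finset.Icc 1 ℓ) S') {L L' : List (List ℤ)} {τ τ' : List ℤ}
    (h : IsListing ℓ S L τ) (h' : IsListing ℓ S' L' τ') (heq : encode L τ = encode L' τ') :
    S = S' := by
  have hp := h.isPartition hS
  have hp' := h'.isPartition hS'
  have hd := congrArg decode heq
  rw [decode_encode (fun σ hσ => hp.nonempty σ (by simp [hσ])),
    decode_encode (fun σ hσ => hp'.nonempty σ (by simp [hσ])), Prod.mk.injEq] at hd
  obtain ⟨rfl, hd⟩ := hd
  obtain ⟨t, a, rfl⟩ := (List.eq_nil_or_concat τ).resolve_left (hp.nonempty τ (by simp))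
  obtain ⟨t', a', rfl⟩ := (List.eq_nil_or_concat τ').resolve_left (hp'.nonempty τ' (by simp))
  rw [List.concat_eq_append] at h hp hd
  rw [List.concat_eq_append] at h' hp' hd
  rw [List.dropLast_concat, List.dropLast_concat] at hd
  subst hd
  have ha := hp.last_nonneg (t ++ [a]) (by simp) a (by simp)
  have ha' := hp'.last_nonneg (t ++ [a']) (by simp) a' (by simp)
  have hmem := (hp'.mem_iff _).2 ((hp.mem_iff a.natAbs).1 (by simp))
  have hnd := hp.nodup
  have hf : ∀ b : ℤ, (L ++ [t ++ [b]]).flatten.map Int.natAbs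
      = (L.flatten ++ t).map Int.natAbs ++ [b.natAbs] := fun b => by simp
  rw [hf, List.nodup_append] at hnd
  rw [hf, List.mem_append, List.mem_singleton] at hmem
  -- The omitted entry has the only absolute value missing from the word, and it is non-negative.
  have haa : a = a' := by
    have := hmem.resolve_left fun h3 => hnd.2.2 _ h3 _ (by simp) rfl
    omega
  subst haa
  ext σ
  rw [← h.mem_iff, ← h'.mem_iff]

/-- Every word comes from a signed partition into lists. -/
theorem ZGood.exists_isListing {z : List (ℤ × Bool)} (hz : ZGood ℓ z) (hlen : z.length + 1 = ℓ) :
    ∃ (S : Finset (List ℤ)) (L : List (List ℤ)) (τ : List ℤ), IsSPIL (Finset.Icc 1 ℓ) S ∧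
      IsListing ℓ S L τ ∧ encode L τ = z := by
  obtain ⟨L, t, hL, henc⟩ := exists_encode z
  set A := (z.map fun s => s.1.natAbs) with hA
  have hAnd : A.Nodup := by
    rw [hA, List.Nodup, List.pairwise_map]
    exact hz.pair.imp fun h => h.1
  have hAsub : A.toFinset ⊆ Finset.Icc 1 ℓ := by
    intro a ha
    obtain ⟨s, hs, rfl⟩ := List.mem_map.1 (List.mem_toFinset.1 ha)
    have := hz.range s hs
    exact Finset.mem_Icc.2 ⟨this.1, this.2.1⟩
  have hAcard : A.toFinset.card + 1 = ℓ := by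
    rw [List.toFinset_card_of_nodup hAnd, hA, List.length_map, hlen]
  -- The `ℓ - 1` letters leave one absolute value over, which becomes the last entry of `σ_t`.
  obtain ⟨a, ha, haA⟩ := Finset.exists_mem_notMem_of_card_lt_card
    (s := A.toFinset) (t := Finset.Icc 1 ℓ) (by rw [Nat.card_Icc]; omega)
  rw [List.mem_toFinset] at haA
  have henc := henc (a : ℤ)
  have hflat : (L ++ [t ++ [(a : ℤ)]]).flatten.map Int.natAbs = A ++ [a] := by
    have h1 := map_fst_encode L (t ++ [(a : ℤ)])
    rw [henc, List.dropLast_concat] at h1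
    have h2 : A = (L.flatten ++ t).map Int.natAbs := by
      rw [← h1, hA, List.map_map]; rfl
    rw [h2]
    simp
  have hnd : (A ++ [a]).Nodup := by
    rw [List.nodup_append]
    refine ⟨hAnd, by simp, fun b hb c hc => ?_⟩
    rw [List.mem_singleton.1 hc]
    exact fun h => haA (h ▸ hb)
  have hfin : (A ++ [a]).toFinset = Finset.Icc 1 ℓ := by
    refine Finset.eq_of_subset_of_card_le ?_ ?_
    · intro b hb
      rcases List.mem_append.1 (List.mem_toFinset.1 hb) with h | h
      · exact hAsub (List.mem_toFinset.2 h)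
      · rwa [List.mem_singleton.1 h]
    · rw [List.toFinset_card_of_nodup hnd, Nat.card_Icc, List.length_append, hA, List.length_map,
        List.length_singleton, hlen]
      omega
  have hlast : ∀ σ ∈ L, ∀ x, σ.getLast? = some x → 0 < x ∧ x < ℓ := by
    intro σ hσ x hx
    have : (x, true) ∈ z := henc ▸ mem_encode_true.2 ⟨σ, hσ, hx⟩
    exact (hz.range _ this).2.2 rfl
  have hp : IsPartition ℓ (L ++ [t ++ [(a : ℤ)]]) := by
    constructor
    · intro σ hσ
      rcases List.mem_append.1 hσ with h | h
      · exact hL σ h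
      · rw [List.mem_singleton.1 h]; simp
    · rw [hflat]; exact hnd
    · intro b
      rw [hflat, ← hfin, List.mem_toFinset]
    · intro σ hσ x hx
      rcases List.mem_append.1 hσ with h | h
      · exact (hlast σ h x hx).1.le
      · rw [List.mem_singleton.1 h, List.getLast?_concat, Option.some.injEq] at hx
        omega
  have hpair := hz.pair
  rw [← henc, encode, List.pairwise_append, List.pairwise_flatMap] at hpair
  refine ⟨_, L, t ++ [(a : ℤ)], hp.isSPIL, ⟨hp.list_nodup, fun σ => List.mem_toFinset.symm, ?_, ?_⟩,
    henc⟩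
  -- A list of `L` cannot contain `±ℓ`: as an inner entry it would precede a marked symbol, and as a
  -- last entry it would violate the range of marked symbols.
  · have h1 := (hp.mem_iff ℓ).2 (Finset.mem_Icc.2 ⟨by omega, le_rfl⟩)
    obtain ⟨x, hx, hxl⟩ := List.mem_map.1 h1
    obtain ⟨σ, hσ, hxσ⟩ := List.mem_flatten.1 hx
    rcases List.mem_append.1 hσ with h | h
    · exfalso
      have h2 := hpair.1.1 σ h
      rw [blockSyms, List.pairwise_append] at h2
      have hne := hL σ h
      have hg := List.getLast?_eq_some_getLast hne
      by_cases hxd : x ∈ σ.dropLast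
      · have := h2.2.2 (x, false) (List.mem_map_of_mem hxd) (σ.getLast hne, true) (by simp [hg])
        exact (this.2 rfl).1 hxl
      · have hxl' : x = σ.getLast hne := by
          rw [← List.dropLast_append_getLast hne, List.mem_append, List.mem_singleton] at hxσ
          exact hxσ.resolve_left hxd
        have := hlast σ h x (by rw [hxl', hg])
        omega
    · rw [← List.mem_singleton.1 h]
      exact natAbs_mem_map.1 (hxl ▸ List.mem_map_of_mem hxσ)
  · refine hpair.1.2.imp fun {σ σ'} h b c hb hc => ?_
    exact ((h (b, true) (by simp [blockSyms, hb]) (c, true) (by simp [blockSyms, hc])).2 rfl).2 rfl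

end

/-! ### Symbols versus signed symbols, and the map `Γ`. -/

section
variable {ℓ : ℕ}

/-- The signed symbol corresponding to a symbol: `(j, false)` stands for `e_j` and `(j, true)` for
the hat or tilde vector with index `j`. -/
def Sym.signed (s : Sym ℓ) : ℤ × Bool := if s.2 then (-label s.1, true) else (label s.1, false)

/-- The vector encoded by a signed symbol. -/
def zvec (ℓ : ℕ) (t : Bool) (s : ℤ × Bool) : Fin (2 * ℓ) → ℂ :=
  if s.2 then (if t then tilde ℓ s.1 else hat ℓ s.1) else e ℓ s.1

theorem Sym.signed_injective : Function.Injective (Sym.signed (ℓ := ℓ)) := by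
  rintro ⟨k, _ | _⟩ ⟨k', _ | _⟩ h <;> simp [Sym.signed] at h <;> rw [label_injective h]

theorem Sym.signed_snd (s : Sym ℓ) : s.signed.2 = s.2 := by
  rcases s with ⟨k, _ | _⟩ <;> rfl

theorem Sym.natAbs_signed (s : Sym ℓ) : s.signed.1.natAbs = (label s.1).natAbs := by
  rcases s with ⟨k, _ | _⟩ <;> simp [Sym.signed]

theorem natAbs_label_eq_iff {k k' : Fin (2 * ℓ)} :
    (label k).natAbs = (label k').natAbs ↔ k = k' ∨ k = k'.rev := by
  rw [Int.natAbs_eq_natAbs_iff, ← label_rev, label_injective.eq_iff, label_injective.eq_iff]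

theorem map_zvec_encode (t : Bool) (L : List (List ℤ)) (τ : List ℤ) :
    (encode L τ).map (zvec ℓ t) =
      L.flatMap (blockVectors ℓ (if t then tilde ℓ else hat ℓ)) ++ τ.dropLast.map (e ℓ) := by
  rw [encode, List.map_append, List.map_flatMap, List.map_map]
  congr 2
  funext σ
  rw [blockSyms, blockVectors, List.map_append, List.map_map, List.map_map]
  cases t <;> rfl

theorem orbit_eq_iff {F F' : IsoFlag ℓ} :
    (Quotient.mk _ F : Orbits ℓ) = Quotient.mk _ F' ↔ ∃ g ∈ B ℓ, g • F' = F := by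
  rw [Quotient.eq, MulAction.orbitRel_apply, MulAction.mem_orbit_iff]
  constructor
  · rintro ⟨g, hg⟩
    exact ⟨g.1, g.2, hg⟩
  · rintro ⟨g, hg, hF⟩
    exact ⟨⟨g, hg⟩, hF⟩

variable [NeZero ℓ]

theorem zvec_signed (t : Bool) (s : Sym ℓ) : zvec ℓ t s.signed = vec t s := by
  rcases s with ⟨k, _ | _⟩
  · exact e_label k
  · cases t
    · exact hat_neg_label k
    · exact tilde_neg_label k

theorem natAbs_label_eq_self_iff {k : Fin (2 * ℓ)} :
    (label k).natAbs = ℓ ↔ k = pl ℓ ∨ k = ml ℓ := by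
  rw [← rev_pl, ← natAbs_label_eq_iff, label_pl, Int.natAbs_natCast]

/-- Distinct absolute values of labels encode both `k ≠ k'` and `k ≠ k'.rev`, so the sign change at
marked symbols only affects the order condition. -/
theorem zOk_signed_iff {s s' : Sym ℓ} (hs : s.2 = true → ml ℓ < s.1)
    (hs' : s'.2 = true → ml ℓ < s'.1) : ZOk ℓ s.signed s'.signed ↔ Ok s s' := by
  have h3 : s'.2 = true → s.2 = true → (s.signed.1 < s'.signed.1 ↔ s'.1 < s.1) := by
    intro h' h
    rw [← label_lt_label (hs' h') (hs h)]
    simp [Sym.signed, h, h']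
  rw [ZOk, Ok, Sym.natAbs_signed, Sym.natAbs_signed, Sym.signed_snd, Sym.signed_snd, Ne,
    natAbs_label_eq_iff, Ne, natAbs_label_eq_self_iff, not_or, not_or, and_assoc]
  refine and_congr_right fun _ => and_congr_right fun _ => forall_congr' fun h' => ?_
  rw [and_assoc]
  exact and_congr_right fun _ => and_congr_right fun _ => forall_congr' fun h => h3 h' h

theorem zGood_map_signed_iff {w : List (Sym ℓ)} : ZGood ℓ (w.map Sym.signed) ↔ Good w := by
  have hp : (∀ s ∈ w, s.2 = true → ml ℓ < s.1) →
      ((w.map Sym.signed).Pairwise (ZOk ℓ) ↔ w.Pairwise Ok) := fun h => by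
    rw [List.pairwise_map]
    exact List.Pairwise.iff_of_mem fun hs hs' => zOk_signed_iff (h _ hs) (h _ hs')
  constructor
  · intro h
    have hm : ∀ s ∈ w, s.2 = true → ml ℓ < s.1 := fun s hs hs2 => by
      have h1 := (h.range _ (List.mem_map_of_mem hs)).2.2 (by rw [Sym.signed_snd, hs2])
      simp only [Sym.signed, hs2, if_true] at h1
      exact ml_lt_iff.2 ⟨by omega, h1.2⟩
    exact ⟨hm, (hp hm).1 h.pair⟩
  · intro h
    refine ⟨fun z hz => ?_, (hp h.marked).2 h.pair⟩
    obtain ⟨s, hs, rfl⟩ := List.mem_map.1 hz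
    have h1 := one_le_abs_label s.1
    have h2 := abs_label_le s.1
    rw [Int.abs_eq_natAbs] at h1 h2
    rw [Sym.natAbs_signed, Sym.signed_snd]
    refine ⟨by omega, by omega, fun hs2 => ?_⟩
    have h3 := ml_lt_iff.1 (h.marked s hs hs2)
    simp only [Sym.signed, hs2, if_true]
    omega

theorem ZGood.exists_map_signed {z : List (ℤ × Bool)} (hz : ZGood ℓ z) :
    ∃ w : List (Sym ℓ), w.map Sym.signed = z := by
  have : z ∈ Set.range (List.map (Sym.signed (ℓ := ℓ))) := by
    rw [Set.range_list_map]
    rintro ⟨j, b⟩ hs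
    have h := hz.range _ hs
    simp only at h
    cases b
    · obtain ⟨k, hk⟩ := exists_label (ℓ := ℓ) (j := j) (by rw [Int.abs_eq_natAbs]; omega)
        (by rw [Int.abs_eq_natAbs]; omega)
      exact ⟨(k, false), by simp [Sym.signed, hk]⟩
    · have h1 := h.2.2 rfl
      obtain ⟨k, -, hk⟩ := exists_neg_label (ℓ := ℓ) (j := j) (by omega) h1.2
      exact ⟨(k, true), by simp [Sym.signed, hk]⟩
  exact this

open Classical in
/-- The vectors in the definition of `Γ` are those encoded by the word of the partition. -/
theorem gammaVectors_eq {L : List (List ℤ)} {τ : List ℤ} (h : IsPartition ℓ (L ++ [τ]))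
    (hτ : (ℓ : ℤ) ∈ τ ∨ (-ℓ : ℤ) ∈ τ) {w : List (Sym ℓ)} (hw : w.map Sym.signed = encode L τ) :
    gammaVectors ℓ L τ = w.map (vec (tl w)) := by
  have htl : (tl w = true) ↔ ¬ (τ.getLast? = some (ℓ : ℤ) ∨ (-ℓ : ℤ) ∈ τ) := by
    rw [tl_eq_true, ← mem_encode_iff h hτ, ← hw, ← label_pl]
    exact (List.mem_map_of_injective Sym.signed_injective (a := ((pl ℓ, false) : Sym ℓ))).symm
  have hmap : w.map (vec (tl w)) = (encode L τ).map (zvec ℓ (tl w)) := by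
    rw [← hw, List.map_map]
    exact List.map_congr_left fun s _ => (zvec_signed _ s).symm
  rw [hmap, map_zvec_encode, gammaVectors]
  congr 3
  by_cases hc : τ.getLast? = some (ℓ : ℤ) ∨ (-ℓ : ℤ) ∈ τ
  · rw [if_pos hc, if_neg (fun h' => htl.1 h' hc)]
  · rw [if_neg hc, if_pos (htl.2 hc)]

/-- This replaces vectors by words, so that existence, uniqueness and injectivity of `Γ` follow from
those for listings, words and `encode`. -/
theorem isGamma_iff {S : SPIL ℓ} {F : IsoFlag ℓ} : IsGamma S F ↔
    ∃ L τ w, IsListing ℓ S.1 L τ ∧ IsWord F w ∧ (List.ofFn w).map Sym.signed = encode L τ := by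
  constructor
  · rintro ⟨L, τ, v, h1, h2, h3, h4, hv, hF⟩
    have hl : IsListing ℓ S.1 L τ := ⟨h1, h2, h3, h4⟩
    have hp := hl.isPartition S.2
    obtain ⟨wl, hwl⟩ := (zGood_encode hp h3 h4).exists_map_signed
    have hlen : wl.length = ℓ - 1 := by
      rw [← length_encode hp, ← hwl, List.length_map]
    have hof : List.ofFn (fun i : Fin (ℓ - 1) => wl.get (i.cast hlen.symm)) = wl := by
      apply List.ext_getElem <;> simp [hlen]
    refine ⟨L, τ, _, hl, ⟨?_, ?_⟩, by rw [hof]; exact hwl⟩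
    · rw [hof, ← zGood_map_signed_iff, hwl]
      exact zGood_encode hp h3 h4
    · rw [gammaVectors_eq hp h3 hwl] at hv
      rw [hof]
      convert hF using 1
      apply List.ofFn_injective
      rw [hv]
      conv_rhs => rw [← hof, List.map_ofFn]
      rw [hof]
      rfl
  · rintro ⟨L, τ, w, hl, hw, henc⟩
    refine ⟨L, τ, _, hl.nodup, hl.mem_iff, hl.mem_last, hl.sorted, ?_, hw.2⟩
    rw [gammaVectors_eq (hl.isPartition S.2) hl.mem_last henc, List.map_ofFn]
    rfl

theorem exists_isGamma (S : SPIL ℓ) : ∃ F, IsGamma S F := by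
  obtain ⟨L, τ, hl⟩ := exists_isListing (NeZero.one_le (n := ℓ)) S.2
  have hp := hl.isPartition S.2
  have hz := zGood_encode hp hl.mem_last hl.sorted
  obtain ⟨wl, hwl⟩ := hz.exists_map_signed
  have hlen : wl.length = ℓ - 1 := by
    rw [← length_encode hp, ← hwl, List.length_map]
  have hof : List.ofFn (fun i : Fin (ℓ - 1) => wl.get (i.cast hlen.symm)) = wl := by
    apply List.ext_getElem <;> simp [hlen]
  obtain ⟨F, hF⟩ := exists_isWord (w := fun i : Fin (ℓ - 1) => wl.get (i.cast hlen.symm))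
    (by rw [hof, ← zGood_map_signed_iff, hwl]; exact hz)
  exact ⟨F, isGamma_iff.2 ⟨L, τ, _, hl, hF, by rw [hof, hwl]⟩⟩

theorem IsGamma.isStandard {S : SPIL ℓ} {F : IsoFlag ℓ} (h : IsGamma S F) : F.IsStandard := by
  obtain ⟨L, τ, w, -, hw, -⟩ := isGamma_iff.1 h
  exact hw.isStandard

theorem IsGamma.unique {S : SPIL ℓ} {F F' : IsoFlag ℓ} (h : IsGamma S F) (h' : IsGamma S F') :
    F = F' := by
  obtain ⟨L, τ, w, hl, hw, henc⟩ := isGamma_iff.1 h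
  obtain ⟨L', τ', w', hl', hw', henc'⟩ := isGamma_iff.1 h'
  obtain ⟨rfl, rfl⟩ := hl.unique NeZero.one_le S.2 hl'
  have : w = w' :=
    List.ofFn_injective (Sym.signed_injective.list_map (henc.trans henc'.symm))
  subst this
  exact IsoFlag.ext (funext fun m => (hw.2 m).trans (hw'.2 m).symm)

/-- A general `g` yields injectivity of `Ψ`; the case `g = 1` yields injectivity of `Γ`. -/
theorem IsGamma.eq_of_smul_eq {S S' : SPIL ℓ} {F F' : IsoFlag ℓ} (h : IsGamma S F)
    (h' : IsGamma S' F') {g : SO (2 * ℓ)} (hg : g ∈ B ℓ) (hF : g • F = F') : S = S' := by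
  obtain ⟨L, τ, w, hl, hw, henc⟩ := isGamma_iff.1 h
  obtain ⟨L', τ', w', hl', hw', henc'⟩ := isGamma_iff.1 h'
  obtain rfl := hw.eq_of_smul_eq hw' hg hF
  exact Subtype.ext (eq_of_encode_eq S.2 S'.2 hl hl' (henc.symm.trans henc'))

theorem exists_isGamma_of_isStandard {F : IsoFlag ℓ} (hF : F.IsStandard) :
    ∃ S : SPIL ℓ, IsGamma S F := by
  obtain ⟨w, hw⟩ := exists_isWord_of_isStandard hF
  have := NeZero.pos ℓ
  obtain ⟨S, L, τ, hS, hl, henc⟩ := (zGood_map_signed_iff.2 hw.good).exists_isListing (by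
    rw [List.length_map, List.length_ofFn]; omega)
  exact ⟨⟨S, hS⟩, isGamma_iff.2 ⟨L, τ, w, hl, hw, henc.symm⟩⟩

end

end OrthFlags

/-! ### Assembly of the bijections. -/

theorem mainTheorem6 (ℓ : ℕ) (hℓ : 1 ≤ ℓ) :
    Function.Bijective (OrthFlags.Psi ℓ) ∧
    ∃ Γ : OrthFlags.SPIL ℓ → OrthFlags.StandardFlag ℓ,
      (∀ (S : OrthFlags.SPIL ℓ) (F : OrthFlags.IsoFlag ℓ),
        (Γ S).1 = F ↔ OrthFlags.IsGamma S F) ∧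
      Function.Bijective Γ ∧
      Function.Bijective (fun S => OrthFlags.Psi ℓ (Γ S)) := by
  have : NeZero ℓ := ⟨by omega⟩
  have hPsi : Function.Bijective (OrthFlags.Psi ℓ) := by
    constructor
    · rintro ⟨F, hF⟩ ⟨F', hF'⟩ h
      obtain ⟨g, hg, hgF⟩ := OrthFlags.orbit_eq_iff.1 h
      -- Two standard flags in one orbit are compared through their signed partitions, which
      -- coincide and determine the flag.
      obtain ⟨S, hS⟩ := OrthFlags.exists_isGamma_of_isStandard hF
      obtain ⟨S', hS'⟩ := OrthFlags.exists_isGamma_of_isStandard hF'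
      obtain rfl := hS'.eq_of_smul_eq hS hg hgF
      exact Subtype.ext (hS.unique hS')
    · intro q
      obtain ⟨F, rfl⟩ := Quotient.exists_rep q
      obtain ⟨g, hg, w, hw⟩ := OrthFlags.exists_smul_isWord F
      exact ⟨⟨g • F, hw.isStandard⟩, OrthFlags.orbit_eq_iff.2 ⟨g, hg, rfl⟩⟩
  choose G hG using OrthFlags.exists_isGamma (ℓ := ℓ)
  have hGbij : Function.Bijective
      (fun S => (⟨G S, (hG S).isStandard⟩ : OrthFlags.StandardFlag ℓ)) := by
    constructor
    · intro S S' h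
      have h' : G S = G S' := congrArg Subtype.val h
      exact (hG S).eq_of_smul_eq (hG S') (OrthFlags.B ℓ).one_mem (by rw [one_smul, h'])
    · rintro ⟨F, hF⟩
      obtain ⟨S, hS⟩ := OrthFlags.exists_isGamma_of_isStandard hF
      exact ⟨S, Subtype.ext ((hG S).unique hS)⟩
  refine ⟨hPsi, _, fun S F => ⟨?_, fun h => (hG S).unique h⟩, hGbij, hPsi.comp hGbij⟩
  rintro rfl
  exact hG S
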